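/- Let $\mathbb F_q$ be a finite field with $q$ elements. Let $\mathcal P$ be the set of integer partitions, including the empty partition $\emptyset$. For $\lambda\in\mathcal P$ let $|\lambda|$ be its weight (the sum of its parts), $m_i(\lambda)$ the multiplicity of the part $i$, and $\lambda'_j=\#\{i:\lambda_i\ge j\}$ the parts of the conjugate partition; put $$C(\lambda,Q)=Q^{\sum_{i\ge1}(\lambda'_i)^2}\prod_{i\ge 1}\;\prod_{k=0}^{m_i(\lambda)-1}\bigl(1-Q^{\,k-m_i(\lambda)}\bigr).$$ Let $\mathcal I(q)$ be the set of monic irreducible polynomials over $\mathbb F_q$, and $\mathcal I(q)_d$ the subset of those of degree $d$. For a monic polynomial $\psi$ let $M(\psi)$ be its companion matrix. A function $\Lambda:\mathcal I(q)\to\mathcal P$ with $\Lambda(\phi)=\emptyset$ for all but finitely many $\phi$ has dimension $\dim\Lambda=\sum_\phi|\Lambda(\phi)|\deg\phi$, and it specifies the conjugacy class (under $\mathrm{GL}_n(\mathbb F_q)$, $n=\dim\Lambda$) of the matrix $\bigoplus_\phi\bigoplus_i M(\phi^{\Lambda(\phi)_i})$; we say that it describes the matrices in this class. For each $n\ge1$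 let $\mathcal C_n\subseteq \mathrm{Mat}_n(\mathbb F_q)$ be a union of conjugacy classes, and let $$F_{\mathcal C}(X)=1+\sum_{n\ge1}\frac{|\mathcal C_n|}{|\mathrm{GL}_n(\mathbb F_q)|}X^n,\qquad G_{\mathcal C}(X)=1+\sum_{n\ge1}\#\{\text{conjugacy classes contained in }\mathcal C_n\}\,X^n .$$ For each $\phi\in\mathcal I(q)$ let $\mathcal S_\phi\subseteq\mathcal P$ be a set containing $\emptyset$. The sequence $(\mathcal C_n)_{n\ge1}$ is called partition restricted with respect to $\{\mathcal S_\phi\}$ if for every $n\ge1$ the functions $\Lambda$ describing the elements of $\mathcal C_n$ are exactly those with $\dim\Lambda=n$ and $\Lambda(\phi)\in\mathcal S_\phi$ for all $\phi\in\mathcal I(q)$; it is called partition uniform with respect to $\mathcal S$ if moreover $\mathcal S_\phi=\mathcal S$ for all $\phi$. **Proposition.** If $(\mathcal C_n)$ is partition restricted with respect to $\{\mathcal S_\phi\}$, then, as formal power series over $\mathbb Q$ (infinite sums and products converging coefficientwise, each coefficient being eventually constant), $$F_{\mathcal C}(X)=\prod_{\phi\in\mathcal I(q)}\ \sum_{\lambda\in\mathcal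 S_\phi}\frac{X^{|\lambda|\deg\phi}}{C(\lambda,q^{\deg\phi})},\qquad G_{\mathcal C}(X)=\prod_{\phi\in\mathcal I(q)}\ \sum_{\lambda\in\mathcal S_\phi}X^{|\lambda|\deg\phi}.$$ If $(\mathcal C_n)$ is partition uniform with respect to $\mathcal S$, then $$F_{\mathcal C}(X)=\prod_{d=1}^{\infty}\Bigl(\sum_{\lambda\in\mathcal S}\frac{X^{|\lambda|d}}{C(\lambda,q^{d})}\Bigr)^{|\mathcal I(q)_d|},\qquad G_{\mathcal C}(X)=\prod_{d=1}^{\infty}\Bigl(\sum_{\lambda\in\mathcal S}X^{|\lambda|d}\Bigr)^{|\mathcal I(q)_d|}.$$ -/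

import Mathlib

open Polynomial

/-- The set `𝒫` of all integer partitions (of arbitrary size), the empty one included. -/
abbrev IntPartition : Type := Σ n : ℕ, Nat.Partition n

namespace IntPartition

/-- The weight `|l|`, the sum of the parts. -/
def weight (l : IntPartition) : ℕ := l.1

/-- The multiset of (positive) parts. -/
def parts (l : IntPartition) : Multiset ℕ := l.2.parts

/-- The empty partition. -/
def empty : IntPartition := ⟨0, default⟩

/-- The part `l'_j = #{i | l_i ≥ j}` (for `j ≥ 1`) of the conjugate partition. -/
def conjPart (l : IntPartition) (j : ℕ) : ℕ := l.parts.countP (fun x => j ≤ x)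

/-- The multiplicity `m_i(l)` (for `i ≥ 1`). -/
def mult (l : IntPartition) (i : ℕ) : ℕ := l.parts.count i

end IntPartition

/-- The `q`-Pochhammer symbol `(a; q)_n = ∏_{k=0}^{n-1} (1 - a q^k)`. -/
def qPochhammer (a q : ℚ) (n : ℕ) : ℚ := ∏ k ∈ Finset.range n, (1 - a * q ^ k)

/-- `C(l, q) = q ^ (∑_{i ≥ 1} (l'_i)²) * ∏_{i ≥ 1} (q^{-m_i(l)}; q)_{m_i(l)}`. No part exceeds
`|l|`, so the indices `i > |l|` contribute nothing. -/
def centralizerWeight (l : IntPartition) (q : ℚ) : ℚ :=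
  q ^ (∑ i ∈ Finset.Icc 1 l.weight, l.conjPart i ^ 2) *
    ∏ i ∈ Finset.Icc 1 l.weight, qPochhammer ((q ^ l.mult i)⁻¹) q (l.mult i)

/-- The set `ℐ(q)` of monic irreducible polynomials over `F`. -/
abbrev MonicIrred (F : Type*) [Field F] : Type _ := {φ : F[X] // φ.Monic ∧ Irreducible φ}

/-- The companion matrix `M(φ)` of a (monic) polynomial: ones on the superdiagonal and last row
`-a_0, …, -a_{d-1}`. -/
def companionMatrix {F : Type*} [Field F] (φ : F[X]) :
    Matrix (Fin φ.natDegree) (Fin φ.natDegree) F :=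
  Matrix.of fun i j =>
    if (i : ℕ) + 1 = φ.natDegree then -φ.coeff j
    else if (j : ℕ) = (i : ℕ) + 1 then 1 else 0

/-- Functions `Λ : ℐ(q) → 𝒫` with `Λ(φ) = ∅` for all but finitely many `φ`. -/
abbrev ClassData (F : Type*) [Field F] : Type _ :=
  {L : MonicIrred F → IntPartition // {φ | L φ ≠ IntPartition.empty}.Finite}

namespace ClassData

variable {F : Type*} [Field F]

/-- `dim Λ = ∑_φ |Λ(φ)| deg φ`. -/
noncomputable def dim (L : ClassData F) : ℕ :=
  ∑ᶠ φ : MonicIrred F, (L.1 φ).weight * φ.1.natDegree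

/-- The blocks of the rational canonical form: pairs of `φ` and a part of `Λ(φ)`, parts being
counted with multiplicity. -/
abbrev Block (L : ClassData F) : Type _ := Σ φ : MonicIrred F, (L.1 φ).parts.ToType

/-- The polynomial `φ ^ Λ(φ)_i` belonging to a block. -/
noncomputable def blockPoly (L : ClassData F) (b : L.Block) : F[X] := b.1.1 ^ b.2.1

open Classical in
/-- The standard representative `⨁_φ ⨁_i M(φ ^ Λ(φ)_i)`. -/
noncomputable def standardRep (L : ClassData F) :
    Matrix (Σ b : L.Block, Fin (L.blockPoly b).natDegree)
      (Σ b : L.Block, Fin (L.blockPoly b).natDegree) F :=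
  Matrix.blockDiagonal' fun b => companionMatrix (L.blockPoly b)

/-- `Λ` specifies the conjugacy class of `A`: for some ordering of the rows and columns of the
standard representative by `0, …, n-1`, it is conjugate to `A` by an invertible matrix. -/
def Specifies (L : ClassData F) {n : ℕ} (A : Matrix (Fin n) (Fin n) F) : Prop :=
  ∃ e : (Σ b : L.Block, Fin (L.blockPoly b).natDegree) ≃ Fin n,
    IsConj (Matrix.reindex e e L.standardRep) A

end ClassData

section Restricted

variable {F : Type*} [Field F]

/-- Each `C n`, `n ≥ 1`, is a union of conjugacy classes of `n × n` matrices. -/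
def IsUnionOfClasses (C : ∀ n : ℕ, Set (Matrix (Fin n) (Fin n) F)) : Prop :=
  ∀ n, 1 ≤ n → ∀ A ∈ C n, ∀ B, IsConj A B → B ∈ C n

/-- The sequence `C` is partition restricted with respect to the family `S`: every `S φ` contains
the empty partition and, for `n ≥ 1`, the `Λ` that describe the elements of `C n` are exactly those
with `dim Λ = n` and `Λ(φ) ∈ S φ` for all `φ`. -/
def IsPartitionRestricted (C : ∀ n : ℕ, Set (Matrix (Fin n) (Fin n) F))
    (S : MonicIrred F → Set IntPartition) : Prop :=
  (∀ φ, IntPartition.empty ∈ S φ) ∧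
  ∀ n, 1 ≤ n → {L : ClassData F | ∃ A ∈ C n, L.Specifies A} =
    {L : ClassData F | L.dim = n ∧ ∀ φ, L.1 φ ∈ S φ}

/-- The sequence `C` is partition uniform with respect to `S`. -/
def IsPartitionUniform (C : ∀ n : ℕ, Set (Matrix (Fin n) (Fin n) F))
    (S : Set IntPartition) : Prop :=
  IsPartitionRestricted C fun _ => S

/-- `F_C(X) = 1 + ∑_{n ≥ 1} |C_n| / |GL_n(F)| X^n`. -/
noncomputable def elementSeries (C : ∀ n : ℕ, Set (Matrix (Fin n) (Fin n) F)) : PowerSeries ℚ :=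
  PowerSeries.mk fun n =>
    if n = 0 then 1 else ((C n).ncard : ℚ) / (Nat.card (Matrix.GeneralLinearGroup (Fin n) F) : ℚ)

/-- `G_C(X) = 1 + ∑_{n ≥ 1} #{conjugacy classes in C_n} X^n`. -/
noncomputable def classSeries (C : ∀ n : ℕ, Set (Matrix (Fin n) (Fin n) F)) : PowerSeries ℚ :=
  PowerSeries.mk fun n => if n = 0 then 1 else ((ConjClasses.mk '' C n).ncard : ℚ)

/-- `|ℐ(q)_d|`, the number of monic irreducible polynomials of degree `d`. -/
noncomputable def numIrred (F : Type*) [Field F] (d : ℕ) : ℕ :=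
  Nat.card {φ : MonicIrred F // φ.1.natDegree = d}

end Restricted

section Formal

open scoped PowerSeries.WithPiTopology

/-- The product of the family `f` converges to `g` as a formal power series: for the product
topology with discrete coefficients, i.e. each coefficient of the finite partial products is
eventually that of `g`. -/
def HasFormalProd {ι : Type*} (f : ι → PowerSeries ℚ) (g : PowerSeries ℚ) : Prop :=
  letI : TopologicalSpace ℚ := ⊥
  HasProd f g

/-- The sum of the family `f` converges to `g` as a formal power series (discrete coefficients). -/
def HasFormalSum {ι : Type*} (f : ι → PowerSeries ℚ) (g : PowerSeries ℚ) : Prop :=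
  letI : TopologicalSpace ℚ := ⊥
  HasSum f g

/-- The formal power series `∑_{l ∈ S} w(l) X^{|l| d}`. -/
noncomputable def partitionSeries (S : Set IntPartition) (w : IntPartition → ℚ) (d : ℕ) :
    PowerSeries ℚ :=
  letI : TopologicalSpace ℚ := ⊥
  ∑' l : S, PowerSeries.monomial (l.1.weight * d) (w l.1)

/-- For `d ≥ 1` the series defining `partitionSeries` converges. -/
theorem hasFormalSum_partitionSeries (S : Set IntPartition) (w : IntPartition → ℚ) (d : ℕ)
    (hd : 1 ≤ d) :
    HasFormalSum (fun l : S => PowerSeries.monomial (l.1.weight * d) (w l.1))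
      (partitionSeries S w d) := by
  let _ : TopologicalSpace ℚ := ⊥
  have hs : Summable fun l : S => PowerSeries.monomial (R := ℚ) (l.1.weight * d) (w l.1) := by
    rw [PowerSeries.WithPiTopology.summable_iff_summable_coeff]
    intro k
    apply summable_of_hasFiniteSupport
    have hfin : {l : IntPartition | l.weight ≤ k}.Finite := by
      have : {l : IntPartition | l.weight ≤ k} =
          ⋃ n ∈ Set.Iic k, Set.range (fun p : Nat.Partition n => (⟨n, p⟩ : IntPartition)) := by
        ext ⟨n, p⟩
        simp only [IntPartition.weight, Set.mem_ofPred_eq, Set.mem_iUnion, Set.mem_Iic,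
          Set.mem_range]
        constructor
        · intro h
          exact ⟨n, h, p, rfl⟩
        · rintro ⟨m, hm, p', h⟩
          cases h
          exact hm
      rw [this]
      exact (Set.finite_Iic k).biUnion fun n _ => Set.finite_range _
    refine (hfin.preimage Subtype.val_injective.injOn).subset ?_
    intro l hl
    simp only [Function.mem_support, PowerSeries.coeff_monomial, ne_eq, ite_eq_right_iff,
      Classical.not_imp] at hl
    simp only [Set.mem_preimage, Set.mem_ofPred_eq]
    rw [hl.1]
    exact Nat.le_mul_of_pos_right _ hd
  exact hs.hasSum

end Formal

/-- `A` is the matrix, acting on row vectors, of the multiplication by `X` in the basis `b`. -/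
def IsMulXMatrix {F : Type*} [Field F] {M : Type*} [AddCommGroup M] [Module F M] [Module F[X] M]
    {σ : Type*} [Fintype σ] (b : Module.Basis σ F M) (A : Matrix σ σ F) : Prop :=
  ∀ i, (X : F[X]) • b i = ∑ j, A i j • b j

section MulX

variable {F : Type*} [Field F] {M : Type*} [AddCommGroup M] [Module F M] [Module F[X] M]
  {N : Type*} [AddCommGroup N] [Module F N] [Module F[X] N]
  {σ τ : Type*} [Fintype σ] [Fintype τ]

theorem IsMulXMatrix.reindex {b : Module.Basis σ F M} {A : Matrix σ σ F} (h : IsMulXMatrix b A)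
    (e : σ ≃ τ) : IsMulXMatrix (b.reindex e) (Matrix.reindex e e A) := by
  intro i
  simp only [Module.Basis.reindex_apply, h (e.symm i), Matrix.reindex_apply, Matrix.submatrix_apply]
  exact (e.symm.sum_comp fun j => A (e.symm i) j • b j).symm

theorem exists_isMulXMatrix (b : Module.Basis σ F M) : ∃ A, IsMulXMatrix b A :=
  ⟨Matrix.of fun i j => b.repr ((X : F[X]) • b i) j, fun i => by
    simp only [Matrix.of_apply]; rw [b.sum_repr]⟩

theorem IsMulXMatrix.unique {b : Module.Basis σ F M} {A B : Matrix σ σ F} (h : IsMulXMatrix b A)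
    (h' : IsMulXMatrix b B) : A = B := by
  ext i j
  have := congrArg (fun x => b.repr x j) ((h i).symm.trans (h' i))
  simpa only [b.repr_sum_self] using this

variable [IsScalarTower F F[X] M] [IsScalarTower F F[X] N]

theorem X_smul_smul_comm (c : F) (m : M) : (X : F[X]) • c • m = c • (X : F[X]) • m :=
  smul_algebra_smul_comm c X m

theorem IsMulXMatrix.isConj [DecidableEq σ] {b b' : Module.Basis σ F M} {A A' : Matrix σ σ F}
    (h : IsMulXMatrix b A) (h' : IsMulXMatrix b' A') : IsConj A A' := by
  have h1 : (b.toMatrix b').transpose * (b'.toMatrix b).transpose = 1 := by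
    rw [← Matrix.transpose_mul, Module.Basis.toMatrix_mul_toMatrix_flip, Matrix.transpose_one]
  have h2 : (b'.toMatrix b).transpose * (b.toMatrix b').transpose = 1 := by
    rw [← Matrix.transpose_mul, Module.Basis.toMatrix_mul_toMatrix_flip, Matrix.transpose_one]
  refine ⟨⟨_, _, h1, h2⟩, ?_⟩
  change (b.toMatrix b').transpose * A = A' * (b.toMatrix b').transpose
  have hb : ∀ i, b' i = ∑ j, b.toMatrix b' j i • b j := fun i => (b.sum_toMatrix_smul_self b' i).symm
  ext i k
  have e1 : (X : F[X]) • b' i = ∑ k, ((b.toMatrix b').transpose * A) i k • b k := by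
    rw [hb i, Finset.smul_sum]
    simp_rw [X_smul_smul_comm, h _, Finset.smul_sum, Matrix.mul_apply, Finset.sum_smul]
    rw [Finset.sum_comm]
    simp [Matrix.transpose_apply, mul_smul]
  have e2 : (X : F[X]) • b' i = ∑ k, (A' * (b.toMatrix b').transpose) i k • b k := by
    rw [h' i]
    simp_rw [hb, Finset.smul_sum, Matrix.mul_apply, Finset.sum_smul]
    rw [Finset.sum_comm]
    simp [Matrix.transpose_apply, mul_smul]
  have := congrArg (fun x => b.repr x k) (e1.symm.trans e2)
  simpa only [b.repr_sum_self] using this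

theorem IsMulXMatrix.exists_of_isConj [DecidableEq σ] {b : Module.Basis σ F M}
    {A A' : Matrix σ σ F} (h : IsMulXMatrix b A) (hA : IsConj A A') :
    ∃ b' : Module.Basis σ F M, IsMulXMatrix b' A' := by
  obtain ⟨c, hc⟩ := hA
  have hdet : IsUnit (c : Matrix σ σ F).transpose.det := by
    rw [Matrix.det_transpose]; exact (Matrix.isUnit_iff_isUnit_det _).1 c.isUnit
  have hb : ∀ i, (b.map (Matrix.toLinearEquiv b _ hdet)) i = ∑ j, (c : Matrix σ σ F) i j • b j := by
    intro i
    rw [Module.Basis.map_apply]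
    change Matrix.toLin b b _ (b i) = _
    rw [Matrix.toLin_self]; rfl
  refine ⟨b.map (Matrix.toLinearEquiv b _ hdet), fun i => ?_⟩
  simp_rw [hb, Finset.smul_sum, X_smul_smul_comm, h _, Finset.smul_sum, smul_smul]
  rw [Finset.sum_comm]
  conv_rhs => rw [Finset.sum_comm]
  refine Finset.sum_congr rfl fun k _ => ?_
  rw [← Finset.sum_smul, ← Finset.sum_smul]
  have := congrFun (congrFun hc i) k
  rw [Matrix.mul_apply, Matrix.mul_apply] at this
  rw [this]

theorem map_polynomial_smul (f : M →ₗ[F] N) (hf : ∀ m, f ((X : F[X]) • m) = (X : F[X]) • f m)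
    (p : F[X]) (m : M) : f (p • m) = p • f m := by
  induction p using Polynomial.induction_on' generalizing m with
  | add p q hp hq => rw [add_smul, map_add, hp, hq, add_smul]
  | monomial n a =>
    induction n generalizing m with
    | zero =>
      rw [monomial_zero_left, ← algebraMap_eq, algebraMap_smul, algebraMap_smul, map_smul]
    | succ n ih =>
      rw [← monomial_mul_X, mul_smul, mul_smul, ih, hf]

theorem IsMulXMatrix.smul_apply_equiv {b : Module.Basis σ F M} {b' : Module.Basis σ F N}
    {A : Matrix σ σ F} (h : IsMulXMatrix b A) (h' : IsMulXMatrix b' A) (m : M) :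
    b.equiv b' (Equiv.refl σ) ((X : F[X]) • m) = (X : F[X]) • b.equiv b' (Equiv.refl σ) m := by
  rw [← b.sum_repr m]
  simp [Finset.smul_sum, X_smul_smul_comm, h _, h' _, -Module.Basis.sum_repr]

/-- Modules on which `X` acts by the same matrix are isomorphic. -/
noncomputable def IsMulXMatrix.linearEquiv {b : Module.Basis σ F M} {b' : Module.Basis σ F N}
    {A : Matrix σ σ F} (h : IsMulXMatrix b A) (h' : IsMulXMatrix b' A) : M ≃ₗ[F[X]] N :=
  { b.equiv b' (Equiv.refl σ) with
    map_smul' := map_polynomial_smul (b.equiv b' (Equiv.refl σ)).toLinearMap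
      (h.smul_apply_equiv h') }

theorem IsMulXMatrix.linearEquiv_apply {b : Module.Basis σ F M} {b' : Module.Basis σ F N}
    {A : Matrix σ σ F} (h : IsMulXMatrix b A) (h' : IsMulXMatrix b' A) (i : σ) :
    h.linearEquiv h' (b i) = b' i := b.equiv_apply i b' (Equiv.refl σ)

theorem IsMulXMatrix.map {b : Module.Basis σ F M} {A : Matrix σ σ F} (h : IsMulXMatrix b A)
    (e : M ≃ₗ[F[X]] N) : IsMulXMatrix (b.map (e.restrictScalars F)) A := by
  intro i
  simp only [Module.Basis.map_apply, LinearEquiv.restrictScalars_apply]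
  rw [← map_smul, h i, map_sum]
  exact Finset.sum_congr rfl fun j _ => (e.restrictScalars F).map_smul _ _

theorem exists_basis_isMulXMatrix_aeval' [DecidableEq σ] (A : Matrix σ σ F) :
    ∃ b : Module.Basis σ F (Module.AEval' (Matrix.toLin' A.transpose)), IsMulXMatrix b A := by
  refine ⟨(Pi.basisFun F σ).map (Module.AEval'.of _), fun i => ?_⟩
  simp only [Module.Basis.map_apply, Module.AEval'.X_smul_of, ← map_smul, ← map_sum]
  congr 1
  ext j
  simp [Matrix.mulVec, dotProduct, Finset.sum_apply, Pi.single_apply]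

end MulX

/-- The cyclic module `F[X] / (f)`. -/
abbrev CyclicModule {F : Type*} [Field F] (f : F[X]) : Type _ := F[X] ⧸ Ideal.span {f}

section Companion

variable {F : Type*} [Field F]

/-- The basis `1, X, …, X ^ (d - 1)` of `F[X] / (f)`. -/
noncomputable def cyclicBasis {f : F[X]} (hf : f.Monic) :
    Module.Basis (Fin f.natDegree) F (CyclicModule f) :=
  AdjoinRoot.powerBasisAux' hf

theorem cyclicBasis_apply {f : F[X]} (hf : f.Monic) (i : Fin f.natDegree) :
    cyclicBasis hf i = Ideal.Quotient.mk _ (X ^ (i : ℕ)) := by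
  have := (AdjoinRoot.powerBasis' hf).basis_eq_pow i
  exact this

theorem isMulXMatrix_companionMatrix {f : F[X]} (hf : f.Monic) :
    IsMulXMatrix (cyclicBasis hf) (companionMatrix f) := by
  intro i
  have hX : (X : F[X]) • cyclicBasis hf i = Ideal.Quotient.mk _ (X ^ ((i : ℕ) + 1)) := by
    rw [cyclicBasis_apply, pow_succ', map_mul]; rfl
  rw [hX]
  by_cases h : (i : ℕ) + 1 = f.natDegree
  · have h1 : ∀ j, companionMatrix f i j = -f.coeff j := fun j => by
      simp [companionMatrix, h]
    simp_rw [h1, cyclicBasis_apply, neg_smul]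
    rw [Finset.sum_neg_distrib, eq_neg_iff_add_eq_zero]
    have h2 : ∀ j : Fin f.natDegree, f.coeff j • (Ideal.Quotient.mk (Ideal.span {f})) (X ^ (j : ℕ))
        = Ideal.Quotient.mk (Ideal.span {f}) (C (f.coeff j) * X ^ (j : ℕ)) := fun j => by
      rw [← smul_eq_C_mul]; rfl
    simp_rw [h2]
    rw [← map_sum, ← map_add, Ideal.Quotient.eq_zero_iff_mem, h,
      Fin.sum_univ_eq_sum_range fun j => C (f.coeff j) * X ^ j, ← hf.as_sum]
    exact Ideal.mem_span_singleton_self f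
  · have hi : (i : ℕ) + 1 < f.natDegree := by omega
    rw [Finset.sum_eq_single (⟨i + 1, hi⟩ : Fin f.natDegree)]
    · simp [companionMatrix, h, cyclicBasis_apply]
    · intro j _ hj
      have : (j : ℕ) ≠ i + 1 := fun h' => hj (Fin.ext h')
      simp [companionMatrix, h, this]
    · simp

variable {ι : Type*} [Fintype ι] [DecidableEq ι] {f : ι → F[X]}

/-- The basis of `⨁ F[X] / (f i)` made of the powers of `X` in the summands. -/
noncomputable def piCyclicBasis (hf : ∀ i, (f i).Monic) :
    Module.Basis (Σ i, Fin (f i).natDegree) F (∀ i, CyclicModule (f i)) :=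
  Pi.basis fun i => cyclicBasis (hf i)

theorem isMulXMatrix_blockDiagonal' (hf : ∀ i, (f i).Monic) :
    IsMulXMatrix (piCyclicBasis hf) (Matrix.blockDiagonal' fun i => companionMatrix (f i)) := by
  rintro ⟨i, k⟩
  rw [Fintype.sum_sigma, Finset.sum_eq_single i]
  · simp only [piCyclicBasis, Pi.basis_apply, Matrix.blockDiagonal'_apply_eq]
    rw [← Pi.single_smul, isMulXMatrix_companionMatrix (hf i) k]
    simp only [← Pi.single_smul]
    exact map_sum (AddMonoidHom.single (fun i => CyclicModule (f i)) i) _ _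
  · intro j _ hj
    refine Finset.sum_eq_zero fun l _ => ?_
    rw [Matrix.blockDiagonal'_apply_ne _ _ _ hj.symm]
    exact zero_smul F (piCyclicBasis hf ⟨j, l⟩)
  · simp

end Companion

namespace ClassData

variable {F : Type*} [Field F] (L : ClassData F)

instance finite_block : Finite L.Block := by
  have : Finite {φ : MonicIrred F | L.1 φ ≠ IntPartition.empty} := L.2
  refine Finite.of_injective (β := Σ φ : {φ : MonicIrred F | L.1 φ ≠ IntPartition.empty},
    (L.1 φ).parts.ToType) (fun b => ⟨⟨b.1, fun h => ?_⟩, b.2⟩) ?_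
  · have hb := b.2
    rw [h] at hb
    exact absurd hb.2.2 (by simp [IntPartition.parts, IntPartition.empty])
  · rintro ⟨φ, b⟩ ⟨ψ, c⟩ h
    simp only [Sigma.mk.injEq, Subtype.mk.injEq] at h
    obtain ⟨rfl, h⟩ := h
    rw [eq_of_heq h]

noncomputable instance fintype_block : Fintype L.Block := Fintype.ofFinite _

theorem blockPoly_monic (b : L.Block) : (L.blockPoly b).Monic := b.1.2.1.pow _

/-- The module `⨁_φ ⨁_i F[X] / (φ ^ Λ(φ)_i)`. -/
abbrev Mod : Type _ := ∀ b : L.Block, CyclicModule (L.blockPoly b)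

open Classical in
theorem specifies_iff {n : ℕ} (A : Matrix (Fin n) (Fin n) F) :
    L.Specifies A ↔ ∃ b : Module.Basis (Fin n) F L.Mod, IsMulXMatrix b A := by
  have hs : IsMulXMatrix (piCyclicBasis L.blockPoly_monic) L.standardRep :=
    isMulXMatrix_blockDiagonal' L.blockPoly_monic
  constructor
  · rintro ⟨e, he⟩
    exact (hs.reindex e).exists_of_isConj he
  · rintro ⟨b, hb⟩
    let e := (piCyclicBasis L.blockPoly_monic).indexEquiv b
    exact ⟨e, (hs.reindex e).isConj hb⟩

end ClassData

namespace IntPartition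

theorem ext_parts {l m : IntPartition} (h : l.parts = m.parts) : l = m := by
  obtain ⟨n, p⟩ := l
  obtain ⟨n', p'⟩ := m
  have hn : n = n' := by
    rw [← p.parts_sum, ← p'.parts_sum]; exact congrArg Multiset.sum h
  subst hn
  congr 1
  exact Nat.Partition.ext h

@[simp] theorem parts_empty : empty.parts = 0 := by simp [parts, empty]

theorem parts_sum (l : IntPartition) : l.parts.sum = l.weight := l.2.parts_sum

theorem parts_pos (l : IntPartition) {i : ℕ} (hi : i ∈ l.parts) : 0 < i := l.2.parts_pos hi

/-- The partition with a given multiset of positive parts. -/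
def ofParts (s : Multiset ℕ) (hs : ∀ i ∈ s, 0 < i) : IntPartition := ⟨s.sum, s, hs _, rfl⟩

@[simp] theorem parts_ofParts (s : Multiset ℕ) (hs : ∀ i ∈ s, 0 < i) : (ofParts s hs).parts = s :=
  rfl

theorem eq_empty_iff (l : IntPartition) : l = empty ↔ l.weight = 0 := by
  constructor
  · rintro rfl; rfl
  · intro h
    apply ext_parts
    rw [parts_empty, Multiset.eq_zero_iff_forall_notMem]
    intro i hi
    have h1 := l.parts_pos hi
    have h2 := Multiset.le_sum_of_mem hi
    rw [l.parts_sum] at h2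
    omega

end IntPartition

theorem Finset.exists_map_val_equiv {I β : Type*} [DecidableEq I] [DecidableEq β] (s : Finset I)
    (e : I → β) : ∃ T : s.val.map e ≃ {i // i ∈ s}, ∀ b, e (T b).1 = b.1 := by
  let G : s.val.ToType → {i // i ∈ s} := fun x => ⟨x.1, Multiset.coe_mem⟩
  have hG : Function.Bijective G := by
    constructor
    · rintro ⟨x, i, hi⟩ ⟨y, j, hj⟩ h
      obtain rfl : x = y := congrArg Subtype.val h
      have := Multiset.nodup_iff_count_le_one.1 s.nodup x
      obtain rfl : i = j := by omega
      rfl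
    · rintro ⟨x, hx⟩
      exact ⟨⟨x, 0, Multiset.count_pos.2 hx⟩, rfl⟩
  refine ⟨(Multiset.mapEquiv s.val e).symm.trans (Equiv.ofBijective G hG), fun b => ?_⟩
  have := Multiset.mapEquiv_apply s.val e ((Multiset.mapEquiv s.val e).symm b)
  rw [Equiv.apply_symm_apply] at this
  exact this.symm

namespace ClassData

variable {F : Type*} [Field F] (L : ClassData F)

@[to_additive]
theorem prod_block_eq_finprod {A : Type*} [CommMonoid A] (g : MonicIrred F → ℕ → A) :
    ∏ b : L.Block, g b.1 b.2.1 = ∏ᶠ φ, ((L.1 φ).parts.map (g φ)).prod := by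
  classical
  rw [finprod_eq_prod_of_mulSupport_subset (s := L.2.toFinset)]
  · have hu : (Finset.univ : Finset L.Block) = L.2.toFinset.sigma fun _ => Finset.univ := by
      ext ⟨φ, b⟩
      simp only [Finset.mem_univ, Finset.mem_sigma, and_true, Set.Finite.mem_toFinset, true_iff]
      intro h
      rw [h] at b
      exact absurd b.2.2 (by simp)
    rw [hu, Finset.prod_sigma]
    refine Finset.prod_congr rfl fun φ _ => ?_
    rw [Finset.prod_eq_multiset_prod]
    exact congrArg Multiset.prod (Multiset.map_univ _ (g φ))
  · intro φ h
    simp only [Set.Finite.coe_toFinset, Set.mem_ofPred_eq]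
    intro h'
    simp [h'] at h

theorem sum_natDegree_blockPoly : ∑ b : L.Block, (L.blockPoly b).natDegree = L.dim := by
  have := L.sum_block_eq_finsum fun φ k => (φ.1 ^ k).natDegree
  refine Eq.trans this ?_
  unfold dim
  congr 1
  ext φ
  simp only [natDegree_pow]
  rw [Multiset.sum_map_mul_right, Multiset.map_id', IntPartition.parts_sum]

theorem finrank_mod : Module.finrank F L.Mod = L.dim := by
  classical
  rw [Module.finrank_eq_card_basis (piCyclicBasis L.blockPoly_monic), Fintype.card_sigma]
  simp [L.sum_natDegree_blockPoly]

theorem finite_mod : Module.Finite F L.Mod := by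
  classical
  exact Module.Finite.of_basis (piCyclicBasis L.blockPoly_monic)

theorem exists_basis {n : ℕ} (h : L.dim = n) : Nonempty (Module.Basis (Fin n) F L.Mod) := by
  have := L.finite_mod
  exact ⟨Module.finBasisOfFinrankEq _ _ (L.finrank_mod.trans h)⟩

theorem exists_specifies {n : ℕ} (h : L.dim = n) : ∃ A : Matrix (Fin n) (Fin n) F, L.Specifies A := by
  obtain ⟨b⟩ := L.exists_basis h
  obtain ⟨A, hA⟩ := exists_isMulXMatrix b
  exact ⟨A, (L.specifies_iff A).2 ⟨b, hA⟩⟩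

variable {L}

theorem Specifies.of_isConj {n : ℕ} {A B : Matrix (Fin n) (Fin n) F} (h : L.Specifies A)
    (hAB : IsConj A B) : L.Specifies B := by
  obtain ⟨e, he⟩ := h
  exact ⟨e, he.trans hAB⟩

theorem Specifies.isConj {n : ℕ} {A B : Matrix (Fin n) (Fin n) F} (hA : L.Specifies A)
    (hB : L.Specifies B) : IsConj A B := by
  obtain ⟨b, hb⟩ := (L.specifies_iff A).1 hA
  obtain ⟨c, hc⟩ := (L.specifies_iff B).1 hB
  exact hb.isConj hc

theorem Specifies.linearEquiv {L' : ClassData F} {n : ℕ} {A : Matrix (Fin n) (Fin n) F}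
    (h : L.Specifies A) (h' : L'.Specifies A) : Nonempty (L.Mod ≃ₗ[F[X]] L'.Mod) := by
  obtain ⟨b, hb⟩ := (L.specifies_iff A).1 h
  obtain ⟨c, hc⟩ := (L'.specifies_iff A).1 h'
  exact ⟨hb.linearEquiv hc⟩

open Classical in
/-- The class data whose blocks correspond to a finite family of powers of irreducibles. -/
noncomputable def ofFamily {I : Type*} [Fintype I] (p : I → MonicIrred F) (e : I → ℕ)
    (he : ∀ i, 0 < e i) : ClassData F :=
  ⟨fun φ => IntPartition.ofParts ((Finset.univ.filter fun i => p i = φ).val.map e) (by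
      simp only [Multiset.mem_map]; rintro _ ⟨i, -, rfl⟩; exact he i), by
    refine (Set.finite_range p).subset fun φ hφ => ?_
    by_contra h
    apply hφ
    apply IntPartition.ext_parts
    have : (Finset.univ.filter fun i => p i = φ) = ∅ :=
      Finset.filter_eq_empty_iff.2 fun i _ hi => h ⟨i, hi⟩
    simp [this]⟩

open Classical in
theorem exists_block_equiv_ofFamily {I : Type*} [Fintype I] (p : I → MonicIrred F) (e : I → ℕ)
    (he : ∀ i, 0 < e i) : ∃ E : (ofFamily p e he).Block ≃ I,
      ∀ b, (ofFamily p e he).blockPoly b = (p (E b)).1 ^ e (E b) := by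
  have T : ∀ φ, ∃ T : (Finset.univ.filter fun i => p i = φ).val.map e ≃ {i // p i = φ},
      ∀ b, e (T b).1 = b.1 := fun φ => by
    obtain ⟨T, hT⟩ := (Finset.univ.filter fun i => p i = φ).exists_map_val_equiv e
    refine ⟨T.trans (Equiv.subtypeEquivRight fun i => ?_), hT⟩
    rw [Finset.mem_filter, and_iff_right (Finset.mem_univ i)]
  choose T hT using T
  refine ⟨(Equiv.sigmaCongrRight T).trans (Equiv.sigmaFiberEquiv p), fun b => ?_⟩
  have h1 : p (T b.1 b.2).1 = b.1 := (T b.1 b.2).2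
  change b.1.1 ^ b.2.1 = (p (T b.1 b.2).1).1 ^ e (T b.1 b.2).1
  rw [h1]
  exact congrArg (b.1.1 ^ ·) (hT b.1 b.2).symm

theorem exists_specifies_matrix {n : ℕ} (A : Matrix (Fin n) (Fin n) F) :
    ∃ L : ClassData F, L.Specifies A := by
  classical
  obtain ⟨b, hb⟩ := exists_basis_isMulXMatrix_aeval' A
  obtain ⟨ι, _, p, hp, e, ⟨E⟩⟩ := Module.equiv_directSum_of_isTorsion
    (Module.AEval.isTorsion_of_finiteDimensional F (Fin n → F) (Matrix.toLin' A.transpose))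
  let I := {i : ι // 0 < e i}
  let P : I → MonicIrred F := fun i =>
    ⟨normalize (p i), monic_normalize (hp i).ne_zero, (normalize_associated _).irreducible_iff.2 (hp i)⟩
  let L := ofFamily P (fun i => e i) fun i => i.2
  obtain ⟨B, hB⟩ := exists_block_equiv_ofFamily P (fun i : I => e i) fun i => i.2
  let res : (∀ i : ι, F[X] ⧸ F[X] ∙ p i ^ e i) →ₗ[F[X]] ∀ i : I, F[X] ⧸ F[X] ∙ p i.1 ^ e i.1 :=
    LinearMap.pi fun i => LinearMap.proj i.1
  have hres : Function.Bijective res := by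
    constructor
    · intro x y h
      ext i
      by_cases hi : 0 < e i
      · exact congrFun h ⟨i, hi⟩
      · have : Subsingleton (F[X] ⧸ F[X] ∙ p i ^ e i) := by
          rw [Submodule.Quotient.subsingleton_iff, show e i = 0 by omega, pow_zero]
          exact Ideal.span_singleton_one
        exact Subsingleton.elim _ _
    · intro y
      refine ⟨fun i => if hi : 0 < e i then y ⟨i, hi⟩ else 0, ?_⟩
      ext i
      have := i.2
      simp only [res, LinearMap.pi_apply, LinearMap.proj_apply, dif_pos i.2]
      rfl
  have hspan : ∀ b, Ideal.span {L.blockPoly b} = F[X] ∙ p (B b).1 ^ e (B b).1 := by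
    intro b
    rw [hB]
    apply Ideal.span_singleton_eq_span_singleton.2
    exact (normalize_associated _).pow_pow
  let G : L.Mod ≃ₗ[F[X]] ∀ i : I, F[X] ⧸ F[X] ∙ p i.1 ^ e i.1 :=
    (LinearEquiv.piCongrRight fun b => Submodule.quotEquivOfEq _ _ (hspan b)).trans
      (LinearEquiv.piCongrLeft F[X] (fun i : I => F[X] ⧸ F[X] ∙ p i.1 ^ e i.1) B)
  let H := ((E.trans (DirectSum.linearEquivFunOnFintype F[X] ι _)).trans
    (LinearEquiv.ofBijective res hres)).trans G.symm
  exact ⟨L, (L.specifies_iff A).2 ⟨_, hb.map H⟩⟩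

end ClassData

theorem card_torsion_quotient_span_mul {R : Type*} [CommRing R] [IsDomain R] {g h : R} (hg : g ≠ 0)
    (hh : h ≠ 0) :
    Nat.card {x : R ⧸ Ideal.span {g * h} // h • x = 0} = Nat.card (R ⧸ Ideal.span {h}) := by
  let f : R →ₗ[R] R ⧸ Ideal.span {g * h} := (Submodule.mkQ _).comp (LinearMap.mulLeft R g)
  have hf : ∀ r, f r = Ideal.Quotient.mk _ (g * r) := fun r => rfl
  have hker : Ideal.span {h} = LinearMap.ker f := by
    ext r
    rw [LinearMap.mem_ker, hf, Ideal.Quotient.eq_zero_iff_mem, Ideal.mem_span_singleton,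
      Ideal.mem_span_singleton, mul_dvd_mul_iff_left hg]
  rw [hker]
  refine (Nat.card_congr (f.quotKerEquivRange.toEquiv.trans
    (Equiv.subtypeEquivRight fun x => ?_))).symm
  obtain ⟨r, rfl⟩ := Ideal.Quotient.mk_surjective x
  have h1 : h • (Ideal.Quotient.mk (Ideal.span {g * h})) r = Ideal.Quotient.mk _ (h * r) := rfl
  rw [h1, Ideal.Quotient.eq_zero_iff_mem, Ideal.mem_span_singleton]
  constructor
  · rintro ⟨s, hs⟩
    rw [hf, Ideal.Quotient.mk_eq_mk_iff_sub_mem, Ideal.mem_span_singleton] at hs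
    obtain ⟨t, ht⟩ := hs
    exact ⟨s - h * t, by linear_combination -h * ht⟩
  · rintro ⟨t, ht⟩
    exact ⟨t, by rw [hf]; congr 1; exact mul_left_cancel₀ hh (by linear_combination -ht)⟩

theorem Multiset.prod_map_pow_left {α A : Type*} [CommMonoid A] (s : Multiset α) (c : A)
    (f : α → ℕ) : (s.map fun a => c ^ f a).prod = c ^ (s.map f).sum := by
  induction s using Multiset.induction_on with
  | empty => simp
  | cons a s ih => simp [ih, pow_add]

theorem sum_map_min (s : Multiset ℕ) (k : ℕ) :
    (s.map fun a => min a k).sum = ∑ j ∈ Finset.Icc 1 k, s.countP fun x => j ≤ x := by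
  induction s using Multiset.induction_on with
  | empty => simp
  | cons a s ih =>
    simp_rw [Multiset.map_cons, Multiset.sum_cons, Multiset.countP_cons, Finset.sum_add_distrib, ih]
    rw [add_comm, Finset.sum_boole]
    congr 1
    have : (Finset.Icc 1 k).filter (fun j => j ≤ a) = Finset.Icc 1 (min a k) := by
      ext j; simp only [Finset.mem_filter, Finset.mem_Icc]; omega
    rw [this]; simp

section FiniteField

variable {F : Type*} [Field F]

theorem card_cyclicModule {f : F[X]} (hf : f.Monic) :
    Nat.card (CyclicModule f) = Nat.card F ^ f.natDegree := by
  rw [Nat.card_congr (cyclicBasis hf).equivFun.toEquiv, Nat.card_fun]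
  simp

theorem isCoprime_of_ne {φ ψ : MonicIrred F} (h : φ ≠ ψ) : IsCoprime φ.1 ψ.1 := by
  rw [φ.2.2.coprime_iff_not_dvd]
  intro hd
  exact h (Subtype.ext (eq_of_monic_of_associated φ.2.1 ψ.2.1
    (φ.2.2.associated_of_dvd ψ.2.2 hd)))

theorem eq_zero_of_pow_smul_eq_zero {φ ψ : MonicIrred F} (h : φ ≠ ψ) {a k : ℕ}
    {x : CyclicModule (ψ.1 ^ a)} (hx : φ.1 ^ k • x = 0) : x = 0 := by
  obtain ⟨u, v, huv⟩ := (isCoprime_of_ne h).pow (m := k) (n := a)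
  have h2 : ψ.1 ^ a • x = 0 := by
    obtain ⟨r, rfl⟩ := Ideal.Quotient.mk_surjective x
    change Ideal.Quotient.mk _ (ψ.1 ^ a * r) = 0
    rw [Ideal.Quotient.eq_zero_iff_mem, Ideal.mem_span_singleton]
    exact dvd_mul_right _ _
  rw [← one_smul F[X] x, ← huv, add_smul, mul_smul, mul_smul, hx, h2, smul_zero, smul_zero, add_zero]

theorem card_torsion_cyclicModule_pow (φ : MonicIrred F) (a k : ℕ) :
    Nat.card {x : CyclicModule (φ.1 ^ a) // φ.1 ^ k • x = 0} =
      (Nat.card F ^ φ.1.natDegree) ^ min a k := by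
  rcases le_total a k with h | h
  · have : ∀ x : CyclicModule (φ.1 ^ a), φ.1 ^ k • x = 0 := by
      intro x
      obtain ⟨r, rfl⟩ := Ideal.Quotient.mk_surjective x
      change Ideal.Quotient.mk _ (φ.1 ^ k * r) = 0
      rw [Ideal.Quotient.eq_zero_iff_mem, Ideal.mem_span_singleton]
      exact (pow_dvd_pow _ h).mul_right _
    rw [Nat.card_congr (Equiv.subtypeUnivEquiv this), card_cyclicModule (φ.2.1.pow _),
      min_eq_left h, natDegree_pow, ← pow_mul, mul_comm]
  · obtain ⟨c, rfl⟩ := Nat.exists_eq_add_of_le' h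
    rw [pow_add, card_torsion_quotient_span_mul (pow_ne_zero _ φ.2.1.ne_zero)
      (pow_ne_zero _ φ.2.1.ne_zero),
      card_cyclicModule (φ.2.1.pow _), min_eq_right h, natDegree_pow, ← pow_mul, mul_comm]

namespace ClassData

variable (L : ClassData F)

instance finite_module [Finite F] : Finite L.Mod := by
  have := L.finite_mod
  exact Module.finite_of_finite F

theorem card_torsion (φ : MonicIrred F) (k : ℕ) :
    Nat.card {x : L.Mod // φ.1 ^ k • x = 0} =
      (Nat.card F ^ φ.1.natDegree) ^ ∑ j ∈ Finset.Icc 1 k, (L.1 φ).conjPart j := by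
  classical
  have e : {x : L.Mod // φ.1 ^ k • x = 0} ≃
      ∀ b : L.Block, {x : CyclicModule (L.blockPoly b) // φ.1 ^ k • x = 0} :=
    (Equiv.subtypeEquivRight fun x => by rw [funext_iff]; rfl).trans Equiv.subtypePiEquivPi
  have h1 : ∀ b : L.Block, Nat.card {x : CyclicModule (L.blockPoly b) // φ.1 ^ k • x = 0} =
      if b.1 = φ then (Nat.card F ^ φ.1.natDegree) ^ min b.2.1 k else 1 := by
    intro b
    split_ifs with h
    · rw [← h]; exact card_torsion_cyclicModule_pow b.1 b.2.1 k
    · have : Unique {x : CyclicModule (L.blockPoly b) // φ.1 ^ k • x = 0} :=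
        { default := ⟨0, smul_zero _⟩
          uniq := fun x => Subtype.ext (eq_zero_of_pow_smul_eq_zero (Ne.symm h) x.2) }
      exact Nat.card_unique
  rw [Nat.card_congr e, Nat.card_pi, Finset.prod_congr rfl fun b _ => h1 b]
  rw [L.prod_block_eq_finprod fun ψ a =>
    if ψ = φ then (Nat.card F ^ φ.1.natDegree) ^ min a k else 1]
  rw [finprod_eq_single _ φ (by intro ψ h; simp [h])]
  simp only [if_true]
  rw [Multiset.prod_map_pow_left, sum_map_min]
  rfl

variable {L}

theorem eq_of_linearEquiv [Finite F] {L' : ClassData F} (e : L.Mod ≃ₗ[F[X]] L'.Mod) : L = L' := by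
  apply Subtype.ext
  funext φ
  have hcard : ∀ k, ∑ j ∈ Finset.Icc 1 k, (L.1 φ).conjPart j =
      ∑ j ∈ Finset.Icc 1 k, (L'.1 φ).conjPart j := by
    intro k
    have h : Nat.card {x : L.Mod // φ.1 ^ k • x = 0} = Nat.card {x : L'.Mod // φ.1 ^ k • x = 0} :=
      Nat.card_congr (e.toEquiv.subtypeEquiv fun x => by
        change _ ↔ _ • e x = 0
        rw [← map_smul, map_eq_zero_iff e e.injective])
    rw [card_torsion, card_torsion] at h
    exact Nat.pow_right_injective (Nat.one_lt_pow φ.2.2.natDegree_pos.ne' Finite.one_lt_card) h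
  have hconj : ∀ k, (L.1 φ).conjPart (k + 1) = (L'.1 φ).conjPart (k + 1) := by
    intro k
    have h1 := hcard (k + 1)
    rw [Finset.sum_Icc_succ_top (by omega), Finset.sum_Icc_succ_top (by omega), hcard k] at h1
    omega
  have hcount : ∀ (l : IntPartition) k,
      l.conjPart (k + 1) = l.parts.count (k + 1) + l.conjPart (k + 2) := by
    intro l k
    unfold IntPartition.conjPart
    induction l.parts using Multiset.induction_on with
    | empty => simp
    | cons a s ih =>
      simp only [Multiset.countP_cons, Multiset.count_cons, ih]
      split_ifs <;> omega
  apply IntPartition.ext_parts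
  ext k
  cases k with
  | zero =>
    rw [Multiset.count_eq_zero_of_notMem, Multiset.count_eq_zero_of_notMem] <;>
    exact fun h => absurd (IntPartition.parts_pos _ h) (lt_irrefl _)
  | succ k =>
    have h1 := hcount (L.1 φ) k
    have h2 := hcount (L'.1 φ) k
    have h3 : (L.1 φ).conjPart (k + 2) = (L'.1 φ).conjPart (k + 2) := hconj (k + 1)
    rw [hconj k, h3] at h1
    omega

theorem Specifies.unique [Finite F] {L' : ClassData F} {n : ℕ} {A : Matrix (Fin n) (Fin n) F}
    (h : L.Specifies A) (h' : L'.Specifies A) : L = L' :=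
  let ⟨e⟩ := h.linearEquiv h'
  eq_of_linearEquiv e

end ClassData

end FiniteField

theorem AddMonoidHom.card_preimage_of_subset_range {G H : Type*} [AddCommGroup G] [AddCommGroup H]
    [Finite H] [Finite G] (f : G →+ H) (W : Set H) (hW : ∀ w ∈ W, ∃ z, f z = w) :
    Nat.card {z // f z ∈ W} = Nat.card W * Nat.card {z // f z = 0} := by
  classical
  have e : {z // f z ∈ W} ≃ Σ w : W, {z // f z = w.1} :=
    { toFun := fun z => ⟨⟨f z.1, z.2⟩, z.1, rfl⟩
      invFun := fun x => ⟨x.2.1, by rw [x.2.2]; exact x.1.2⟩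
      left_inv := fun z => rfl
      right_inv := by
        rintro ⟨⟨w, hw⟩, z, hz⟩
        have hz' : f z = w := hz
        subst hz'
        rfl }
  have := Fintype.ofFinite W
  have h : ∀ w : W, Nat.card {z // f z = w.1} = Nat.card {z // f z = 0} := by
    intro w
    obtain ⟨z, hz⟩ := hW w.1 w.2
    exact Nat.card_congr ((Equiv.subRight z).subtypeEquiv fun x => by
      rw [Equiv.subRight_apply, map_sub, hz, sub_eq_zero])
  rw [Nat.card_congr e, Nat.card_sigma, Finset.sum_congr rfl fun w _ => h w, Finset.sum_const,
    smul_eq_mul, Finset.card_univ, ← Nat.card_eq_fintype_card]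

section Independent

variable {R : Type*} [CommRing R] {M : Type*} [AddCommGroup M] [Module R M]
  {ι : Type*}

/-- Linear independence modulo `p` of the vectors `y i`, `i ∈ s`. -/
def IndepMod (p : R) (y : ι → M) (s : Finset ι) : Prop :=
  ∀ c : ι → R, ∑ i ∈ s, c i • y i = 0 → ∀ i ∈ s, p ∣ c i

theorem indepMod_congr {p : R} {y y' : ι → M} {s : Finset ι} (h : ∀ i ∈ s, y i = y' i) :
    IndepMod p y s ↔ IndepMod p y' s := by
  unfold IndepMod
  refine forall_congr' fun c => ?_
  rw [Finset.sum_congr rfl fun i hi => by rw [h i hi]]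

theorem indepMod_insert [DecidableEq ι] [IsDomain R] [IsPrincipalIdealRing R] {p : R}
    (hp : Irreducible p) {y : ι → M} {s : Finset ι} {a : ι} (ha : a ∉ s) (hy : p • y a = 0) :
    IndepMod p y (insert a s) ↔ IndepMod p y s ∧ y a ∉ Submodule.span R (y '' s) := by
  constructor
  · intro h
    constructor
    · intro c hc i hi
      have h1 := h (Function.update c a 0) (by
        rw [Finset.sum_insert ha, Function.update_self, zero_smul, zero_add, ← hc]
        refine Finset.sum_congr rfl fun j hj => ?_
        rw [Function.update_of_ne (ne_of_mem_of_not_mem hj ha)]) i (Finset.mem_insert_of_mem hi)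
      rwa [Function.update_of_ne (ne_of_mem_of_not_mem hi ha)] at h1
    · intro hs
      obtain ⟨c, hc⟩ := (Submodule.mem_span_image_finset_iff_exists_fun R).1 hs
      have h1 := h (fun i => if hi : i ∈ s then c ⟨i, hi⟩ else -1) (by
        rw [Finset.sum_insert ha, dif_neg ha, neg_one_smul, neg_add_eq_zero, ← hc]
        rw [← Finset.sum_coe_sort s]
        refine Finset.sum_congr rfl fun j _ => ?_
        rw [dif_pos j.2]) a (Finset.mem_insert_self a s)
      rw [dif_neg ha, dvd_neg] at h1
      exact hp.not_isUnit (isUnit_of_dvd_one h1)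
  · rintro ⟨h, hs⟩ c hc
    rw [Finset.sum_insert ha] at hc
    have hca : p ∣ c a := by
      by_contra hn
      obtain ⟨u, v, huv⟩ := hp.coprime_iff_not_dvd.2 hn
      apply hs
      have h1 : y a = -(v • ∑ i ∈ s, c i • y i) := by
        calc y a = (u * p + v * c a) • y a := by rw [huv, one_smul]
          _ = v • (c a • y a) := by rw [add_smul, mul_smul, hy, smul_zero, zero_add, mul_smul]
          _ = _ := by rw [eq_neg_of_add_eq_zero_left hc, smul_neg]
      rw [h1]
      exact neg_mem (Submodule.smul_mem _ _ (Submodule.sum_mem _ fun i hi =>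
        Submodule.smul_mem _ _ (Submodule.subset_span ⟨i, hi, rfl⟩)))
    have h0 : c a • y a = 0 := by
      obtain ⟨d, hd⟩ := hca
      rw [hd, mul_comm, mul_smul, hy, smul_zero]
    rw [h0, zero_add] at hc
    intro i hi
    rcases Finset.mem_insert.1 hi with rfl | hi
    · exact hca
    · exact h c hc i hi

theorem IndepMod.card_span {p : R} {y : ι → M} {s : Finset ι} (h : IndepMod p y s)
    (hy : ∀ i ∈ s, p • y i = 0) :
    Nat.card (Submodule.span R (y '' s)) = Nat.card (R ⧸ Ideal.span {p}) ^ s.card := by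
  classical
  let g : (s → R) →ₗ[R] M := Fintype.linearCombination R fun i : s => y i
  have hg : ∀ c, g c = ∑ i : s, c i • y i := fun c => Fintype.linearCombination_apply _ _ _
  have hr : Submodule.span R (y '' s) = LinearMap.range g := by
    rw [Fintype.range_linearCombination]
    congr 1
    ext x
    simp
  have hk : LinearMap.ker g = Submodule.pi Set.univ fun _ : s => Ideal.span {p} := by
    ext c
    rw [LinearMap.mem_ker, Submodule.mem_pi, hg]
    simp_rw [Ideal.mem_span_singleton, Set.mem_univ, true_imp_iff]
    constructor
    · intro hc i
      have h1 := h (fun j => if hj : j ∈ s then c ⟨j, hj⟩ else 0) (by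
        rw [← Finset.sum_coe_sort, ← hc]
        refine Finset.sum_congr rfl fun j _ => ?_
        rw [dif_pos j.2]) i i.2
      rwa [dif_pos i.2] at h1
    · intro hc
      refine Finset.sum_eq_zero fun i _ => ?_
      obtain ⟨d, hd⟩ := hc i
      rw [hd, mul_comm, mul_smul, hy i i.2, smul_zero]
  rw [hr, ← Nat.card_congr g.quotKerEquivRange.toEquiv, hk,
    Nat.card_congr (Submodule.quotientPi fun _ : s => Ideal.span {p}).toEquiv, Nat.card_fun]
  simp

/-- Families of vectors `x i` with `p ^ k i • x i = 0`, supported on `s`, such that the vectors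
`p ^ (k i - 1) • x i` are independent modulo `p`. -/
abbrev SocleIndepFamily (M : Type*) [AddCommGroup M] [Module R M] (p : R) (k : ι → ℕ)
    (s : Finset ι) : Type _ :=
  {x : ι → M // (∀ i, i ∉ s → x i = 0) ∧ (∀ i ∈ s, p ^ k i • x i = 0) ∧
    IndepMod p (fun i => p ^ (k i - 1) • x i) s}

/-- Adding a vector to a socle independent family. -/
def socleIndepFamilyInsertEquiv [DecidableEq ι] [IsDomain R] [IsPrincipalIdealRing R] {p : R}
    (hp : Irreducible p) (k : ι → ℕ) (hk : ∀ i, 0 < k i) {s : Finset ι} {a : ι} (ha : a ∉ s) :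
    SocleIndepFamily M p k (insert a s) ≃ Σ x : SocleIndepFamily M p k s,
      {z : M // p ^ k a • z = 0 ∧
        p ^ (k a - 1) • z ∉ Submodule.span R ((fun i => p ^ (k i - 1) • x.1 i) '' s)} where
  toFun x := by
    have h1 : p • p ^ (k a - 1) • x.1 a = 0 := by
      rw [smul_smul, ← pow_succ', Nat.sub_add_cancel (hk a)]
      exact x.2.2.1 a (Finset.mem_insert_self a s)
    have h2 := (indepMod_insert hp ha h1).1 x.2.2.2
    have h3 : ∀ i ∈ s, p ^ (k i - 1) • x.1 i = p ^ (k i - 1) • Function.update x.1 a 0 i :=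
      fun i hi => by rw [Function.update_of_ne (ne_of_mem_of_not_mem hi ha)]
    refine ⟨⟨Function.update x.1 a 0, fun i hi => ?_, fun i hi => ?_, ?_⟩, x.1 a, ?_, ?_⟩
    · by_cases h : i = a
      · rw [h, Function.update_self]
      · rw [Function.update_of_ne h]; exact x.2.1 i (by simp [h, hi])
    · rw [Function.update_of_ne (ne_of_mem_of_not_mem hi ha)]
      exact x.2.2.1 i (Finset.mem_insert_of_mem hi)
    · exact (indepMod_congr h3).1 h2.1
    · exact x.2.2.1 a (Finset.mem_insert_self a s)
    · rw [← Set.image_congr h3]; exact h2.2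
  invFun x := by
    have h3 : ∀ i ∈ s, p ^ (k i - 1) • x.1.1 i =
        p ^ (k i - 1) • Function.update x.1.1 a x.2.1 i :=
      fun i hi => by rw [Function.update_of_ne (ne_of_mem_of_not_mem hi ha)]
    refine ⟨Function.update x.1.1 a x.2.1, fun i hi => ?_, fun i hi => ?_, ?_⟩
    · rw [Finset.mem_insert, not_or] at hi
      rw [Function.update_of_ne hi.1]; exact x.1.2.1 i hi.2
    · rcases Finset.mem_insert.1 hi with rfl | hi
      · rw [Function.update_self]; exact x.2.2.1
      · rw [Function.update_of_ne (ne_of_mem_of_not_mem hi ha)]; exact x.1.2.2.1 i hi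
    · refine (indepMod_insert hp ha ?_).2 ⟨(indepMod_congr h3).1 x.1.2.2.2, ?_⟩
      · simp only [Function.update_self]
        rw [smul_smul, ← pow_succ', Nat.sub_add_cancel (hk a)]
        exact x.2.2.1
      · rw [← Set.image_congr h3]
        simp only [Function.update_self]
        exact x.2.2.2
  left_inv x := by
    apply Subtype.ext
    simp
  right_inv := by
    rintro ⟨⟨x, hx⟩, z, hz⟩
    have h0 : Function.update (Function.update x a z) a 0 = x := by
      rw [Function.update_idem, ← hx.1 a ha, Function.update_eq_self]
    refine Sigma.ext (Subtype.ext h0) ?_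
    refine (Subtype.heq_iff_coe_eq fun w => ?_).2 (Function.update_self _ _ _)
    simp only [h0]

theorem card_torsion_notMem_span [Finite M] {p : R} {k : ι → ℕ} (hk : ∀ i, 0 < k i)
    {s : Finset ι} {a : ι} (hmin : ∀ i ∈ s, k a ≤ k i) (x : SocleIndepFamily M p k s) :
    Nat.card {z : M // p ^ k a • z = 0 ∧
        p ^ (k a - 1) • z ∉ Submodule.span R ((fun i => p ^ (k i - 1) • x.1 i) '' s)} +
      Nat.card (R ⧸ Ideal.span {p}) ^ s.card * Nat.card {z : M // p ^ (k a - 1) • z = 0} =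
    Nat.card {z : M // p ^ k a • z = 0} := by
  classical
  set W := Submodule.span R ((fun i => p ^ (k i - 1) • x.1 i) '' s) with hW
  have hcard : Nat.card W = Nat.card (R ⧸ Ideal.span {p}) ^ s.card := by
    refine x.2.2.2.card_span fun i hi => ?_
    rw [smul_smul, ← pow_succ', Nat.sub_add_cancel (hk i)]
    exact x.2.2.1 i hi
  let G := Submodule.torsionBy R M (p ^ k a)
  let f : G →ₗ[R] M := (p ^ (k a - 1)) • G.subtype
  have hf : ∀ z, f z = p ^ (k a - 1) • z.1 := fun z => rfl
  have hrange : W ≤ LinearMap.range f := by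
    rw [hW, Submodule.span_le]
    rintro _ ⟨i, hi, rfl⟩
    have hi' := hmin i hi
    refine ⟨⟨p ^ (k i - k a) • x.1 i, ?_⟩, ?_⟩
    · rw [Submodule.mem_torsionBy_iff, smul_smul, ← pow_add,
        show k a + (k i - k a) = k i by omega]
      exact x.2.2.1 i hi
    · have := hk a
      rw [hf, smul_smul, ← pow_add, show k a - 1 + (k i - k a) = k i - 1 by omega]
  have h1 := f.toAddMonoidHom.card_preimage_of_subset_range W hrange
  have e1 : {z : G // f z ∈ W} ≃
      {z : {z : M // p ^ k a • z = 0} // p ^ (k a - 1) • z.1 ∈ W} := Equiv.refl _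
  have e2 : {z : G // f z = 0} ≃ {z : M // p ^ (k a - 1) • z = 0} :=
    { toFun := fun z => ⟨z.1.1, z.2⟩
      invFun := fun z => ⟨⟨z.1, by
        rw [Submodule.mem_torsionBy_iff, ← pow_sub_mul_pow p (hk a : 1 ≤ k a), mul_comm, mul_smul,
          z.2, smul_zero]⟩, z.2⟩
      left_inv := fun z => rfl
      right_inv := fun z => rfl }
  have h2 : Nat.card {z : {z : M // p ^ k a • z = 0} // p ^ (k a - 1) • z.1 ∈ W} =
      Nat.card (R ⧸ Ideal.span {p}) ^ s.card * Nat.card {z : M // p ^ (k a - 1) • z = 0} := by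
    rw [← hcard, ← Nat.card_congr e1, ← Nat.card_congr e2]; exact h1
  rw [← h2, ← Nat.card_congr (Equiv.subtypeSubtypeEquivSubtypeInter
    (fun z : M => p ^ k a • z = 0) fun z => p ^ (k a - 1) • z ∉ W), add_comm, ← Nat.card_sum]
  exact Nat.card_congr (Equiv.sumCompl fun z : {z : M // p ^ k a • z = 0} =>
    p ^ (k a - 1) • z.1 ∈ W)

theorem card_socleIndepFamily [DecidableEq ι] [IsDomain R] [IsPrincipalIdealRing R] [Finite M]
    [Finite ι] {p : R} (hp : Irreducible p) (k : ι → ℕ) (hk : ∀ i, 0 < k i) (d : ℕ → ℕ)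
    (hM : ∀ v, Nat.card {z : M // p ^ v • z = 0} =
      Nat.card (R ⧸ Ideal.span {p}) ^ ∑ j ∈ Finset.Icc 1 v, d j)
    (V : Finset ℕ) (s : Finset ι) (hV : ∀ i ∈ s, k i ∈ V) :
    (Nat.card (SocleIndepFamily M p k s) : ℚ) =
      (∏ i ∈ s, (Nat.card (R ⧸ Ideal.span {p}) : ℚ) ^ ∑ j ∈ Finset.Icc 1 (k i - 1), d j) *
      ∏ v ∈ V, ∏ j ∈ Finset.range (s.filter fun i => k i = v).card,
        ((Nat.card (R ⧸ Ideal.span {p}) : ℚ) ^ d v -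
          (Nat.card (R ⧸ Ideal.span {p}) : ℚ) ^ ((s.filter fun i => v < k i).card + j)) := by
  set Q : ℚ := (Nat.card (R ⧸ Ideal.span {p}) : ℚ) with hQ
  induction s using Finset.induction_on_min_value k with
  | empty =>
    have : Unique (SocleIndepFamily M p k ∅) :=
      { default := ⟨fun _ => 0, by simp, by simp, fun c _ i hi => by simp at hi⟩
        uniq := fun x => Subtype.ext (funext fun i => x.2.1 i (by simp)) }
    simp
  | insert a s ha hmin ih =>
    have ih := ih fun i hi => hV i (Finset.mem_insert_of_mem hi)
    have hstep : ∀ x : SocleIndepFamily M p k s, Nat.card {z : M // p ^ k a • z = 0 ∧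
        p ^ (k a - 1) • z ∉ Submodule.span R ((fun i => p ^ (k i - 1) • x.1 i) '' s)} =
        Nat.card {z : M // p ^ k a • z = 0} -
        Nat.card (R ⧸ Ideal.span {p}) ^ s.card * Nat.card {z : M // p ^ (k a - 1) • z = 0} :=
      fun x => Nat.eq_sub_of_add_eq (card_torsion_notMem_span hk hmin x)
    have := Fintype.ofFinite (SocleIndepFamily M p k s)
    have hfac : ∀ x : SocleIndepFamily M p k s, ((Nat.card {z : M // p ^ k a • z = 0} -
        Nat.card (R ⧸ Ideal.span {p}) ^ s.card * Nat.card {z : M // p ^ (k a - 1) • z = 0} : ℕ) : ℚ) =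
        Q ^ (∑ j ∈ Finset.Icc 1 (k a - 1), d j) * (Q ^ d (k a) - Q ^ s.card) := by
      intro x
      rw [Nat.cast_sub (by rw [← card_torsion_notMem_span hk hmin x]; omega), hM, hM]
      obtain ⟨w, hw⟩ : ∃ w, k a = w + 1 := ⟨k a - 1, by have := hk a; omega⟩
      rw [hw, Finset.sum_Icc_succ_top (by omega), Nat.add_sub_cancel]
      push_cast
      rw [← hQ]; ring
    have hcard : (Nat.card (SocleIndepFamily M p k (insert a s)) : ℚ) =
        Nat.card (SocleIndepFamily M p k s) *
          (Q ^ (∑ j ∈ Finset.Icc 1 (k a - 1), d j) * (Q ^ d (k a) - Q ^ s.card)) := by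
      rw [Nat.card_congr (socleIndepFamilyInsertEquiv hp k hk ha), Nat.card_sigma,
        Finset.sum_congr rfl fun x _ => hstep x, Nat.cast_sum, Finset.sum_congr rfl fun x _ => hfac x,
        Finset.sum_const, nsmul_eq_mul, Finset.card_univ, Nat.card_eq_fintype_card]
    have hV' : ∀ v ∈ V, (∏ j ∈ Finset.range ((insert a s).filter fun i => k i = v).card,
        (Q ^ d v - Q ^ (((insert a s).filter fun i => v < k i).card + j))) =
        (∏ j ∈ Finset.range (s.filter fun i => k i = v).card,
          (Q ^ d v - Q ^ ((s.filter fun i => v < k i).card + j))) *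
          if k a = v then Q ^ d (k a) - Q ^ s.card else 1 := by
      intro v _
      rw [Finset.filter_insert, Finset.filter_insert]
      rcases lt_trichotomy (k a) v with h | h | h
      · rw [if_neg h.ne, if_neg h.not_gt, if_neg h.ne, mul_one]
      · subst h
        rw [if_pos rfl, if_neg (lt_irrefl _), if_pos rfl,
          Finset.card_insert_of_notMem (by simp [ha]), Finset.prod_range_succ]
        congr 3
        rw [add_comm, ← Finset.card_union_of_disjoint, ← Finset.filter_or]
        · congr 2
          refine Finset.filter_true_of_mem fun i hi => ?_
          exact (hmin i hi).eq_or_lt.imp_left Eq.symm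
        · exact Finset.disjoint_filter.2 fun i _ h1 h2 => absurd h2 (by rw [h1]; exact lt_irrefl _)
      · have : (s.filter fun i => k i = v) = ∅ :=
          Finset.filter_false_of_mem fun i hi => by have := hmin i hi; omega
        rw [if_neg h.ne', if_neg h.ne', this]
        simp
    rw [hcard, ih, Finset.prod_insert ha, Finset.prod_congr rfl hV', Finset.prod_mul_distrib,
      Finset.prod_ite_eq, if_pos (hV a (Finset.mem_insert_self a s))]
    ring

end Independent

namespace IntPartition

theorem conjPart_eq_mult_add (l : IntPartition) (v : ℕ) :
    l.conjPart v = l.mult v + l.parts.countP fun a => v < a := by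
  unfold conjPart mult
  induction l.parts using Multiset.induction_on with
  | empty => simp
  | cons a s ih =>
    simp only [Multiset.countP_cons, Multiset.count_cons, ih]
    split_ifs <;> omega

theorem sum_sum_conjPart (l : IntPartition) :
    (l.parts.map fun i => ∑ j ∈ Finset.Icc 1 (i - 1), l.conjPart j).sum =
      ∑ v ∈ Finset.Icc 1 l.weight, l.conjPart v * l.parts.countP fun a => v < a := by
  have h : ∀ s : Multiset ℕ, (∀ i ∈ s, i ≤ l.weight) →
      (s.map fun i => ∑ j ∈ Finset.Icc 1 (i - 1), l.conjPart j).sum =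
      ∑ v ∈ Finset.Icc 1 l.weight, l.conjPart v * s.countP fun a => v < a := by
    intro s hs
    induction s using Multiset.induction_on with
    | empty => simp
    | cons a s ih =>
      simp_rw [Multiset.map_cons, Multiset.sum_cons, Multiset.countP_cons, mul_add,
        Finset.sum_add_distrib, ih fun i hi => hs i (Multiset.mem_cons_of_mem hi)]
      rw [add_comm]
      congr 1
      simp_rw [mul_ite, mul_one, mul_zero, ← Finset.sum_filter]
      refine Finset.sum_congr ?_ fun _ _ => rfl
      have := hs a (Multiset.mem_cons_self a s)
      ext j; simp only [Finset.mem_filter, Finset.mem_Icc]; omega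
  exact h _ fun i hi => l.parts_sum ▸ Multiset.le_sum_of_mem hi

theorem centralizerWeight_eq (l : IntPartition) {Q : ℚ} (hQ : Q ≠ 0) :
    (l.parts.map fun i => Q ^ ∑ j ∈ Finset.Icc 1 (i - 1), l.conjPart j).prod *
      ∏ v ∈ Finset.Icc 1 l.weight, ∏ j ∈ Finset.range (l.mult v),
        (Q ^ l.conjPart v - Q ^ ((l.parts.countP fun a => v < a) + j)) =
      centralizerWeight l Q := by
  have h1 : ∀ v, ∏ j ∈ Finset.range (l.mult v),
        (Q ^ l.conjPart v - Q ^ ((l.parts.countP fun a => v < a) + j)) =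
      Q ^ (l.conjPart v * l.mult v) * qPochhammer ((Q ^ l.mult v)⁻¹) Q (l.mult v) := by
    intro v
    have h2 : Q ^ (l.conjPart v * l.mult v) = ∏ _j ∈ Finset.range (l.mult v), Q ^ l.conjPart v := by
      rw [Finset.prod_const, Finset.card_range, pow_mul]
    rw [qPochhammer, h2, ← Finset.prod_mul_distrib]
    refine Finset.prod_congr rfl fun j _ => ?_
    rw [l.conjPart_eq_mult_add v, pow_add, pow_add]
    field_simp
  rw [Multiset.prod_map_pow_left, sum_sum_conjPart, Finset.prod_congr rfl fun v _ => h1 v,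
    Finset.prod_mul_distrib, Finset.prod_pow_eq_pow_sum, ← mul_assoc, ← pow_add,
    ← Finset.sum_add_distrib, centralizerWeight]
  congr 2
  refine Finset.sum_congr rfl fun v _ => ?_
  rw [← mul_add, sq]
  congr 1
  rw [l.conjPart_eq_mult_add v, add_comm]

end IntPartition

section PiQuotient

variable {R : Type*} [CommRing R] {ι : Type*} {a : ι → R}
  {N : Type*} [AddCommGroup N] [Module R N]

/-- The vector with coordinates the classes of `c i`. -/
def piMk (a : ι → R) (c : ι → R) : ∀ i, R ⧸ Ideal.span {a i} :=
  fun i => Ideal.Quotient.mk (Ideal.span {a i}) (c i)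

theorem piMk_apply (c : ι → R) (i : ι) : piMk a c i = Ideal.Quotient.mk (Ideal.span {a i}) (c i) :=
  rfl

theorem smul_piMk_apply (r : R) (c : ι → R) (i : ι) :
    (r • piMk a c) i = Ideal.Quotient.mk (Ideal.span {a i}) (r * c i) := rfl

theorem piMk_smul (r : R) (c : ι → R) : piMk a (r • c) = r • piMk a c :=
  _root_.funext fun _ => rfl

theorem exists_piMk_eq (m : ∀ i, R ⧸ Ideal.span {a i}) : ∃ c, piMk a c = m := by
  choose c hc using fun i => Ideal.Quotient.mk_surjective (m i)
  exact ⟨c, _root_.funext hc⟩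

theorem piMk_eq_zero_iff {c : ι → R} : piMk a c = 0 ↔ ∀ i, a i ∣ c i := by
  rw [funext_iff]
  refine forall_congr' fun i => ?_
  rw [← Ideal.mem_span_singleton]
  exact Ideal.Quotient.eq_zero_iff_mem

theorem smul_map_piMk_single [DecidableEq ι] (f : (∀ i, R ⧸ Ideal.span {a i}) →ₗ[R] N) (i : ι) :
    a i • f (piMk a (Pi.single i 1)) = 0 := by
  rw [← map_smul]
  have : a i • piMk a (Pi.single i 1) = 0 := by
    rw [← piMk_smul, piMk_eq_zero_iff]
    intro j
    by_cases hj : j = i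
    · subst hj; simp
    · simp [hj]
  rw [this, map_zero]

variable [Fintype ι]

theorem exists_linearMap_piMk (x : ι → N) (hx : ∀ i, a i • x i = 0) :
    ∃ f : (∀ i, R ⧸ Ideal.span {a i}) →ₗ[R] N, ∀ c, f (piMk a c) = ∑ i, c i • x i := by
  have h : ∀ i, Ideal.span {a i} ≤ LinearMap.ker (LinearMap.toSpanSingleton R N (x i)) := by
    intro i
    rw [Ideal.span_singleton_le_iff_mem, LinearMap.mem_ker, LinearMap.toSpanSingleton_apply, hx]
  refine ⟨∑ i, (Submodule.liftQ _ _ (h i)).comp (LinearMap.proj i), fun c => ?_⟩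
  rw [LinearMap.sum_apply]
  exact Finset.sum_congr rfl fun i _ => rfl

variable [DecidableEq ι]

theorem sum_ite_mem_smul (s : Finset ι) (c : ι → R) (y : ι → N) :
    ∑ i, (if i ∈ s then c i else 0) • y i = ∑ i ∈ s, c i • y i := by
  simp_rw [ite_smul, zero_smul]
  rw [Finset.sum_ite_mem, Finset.univ_inter]

theorem piMk_eq_sum (c : ι → R) : piMk a c = ∑ i, c i • piMk a (Pi.single i 1) := by
  apply _root_.funext
  intro j
  rw [Finset.sum_apply, Finset.sum_eq_single j]
  · rw [smul_piMk_apply, Pi.single_eq_same, mul_one, piMk_apply]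
  · intro i _ hi
    rw [smul_piMk_apply, Pi.single_eq_of_ne hi.symm, mul_zero, map_zero]
  · simp

theorem exists_linearMap_piMk_single (x : ι → N) (hx : ∀ i, a i • x i = 0) :
    ∃ f : (∀ i, R ⧸ Ideal.span {a i}) →ₗ[R] N, ∀ i, f (piMk a (Pi.single i 1)) = x i := by
  obtain ⟨f, hf⟩ := exists_linearMap_piMk x hx
  refine ⟨f, fun b => ?_⟩
  rw [hf, Finset.sum_eq_single b]
  · rw [Pi.single_eq_same, one_smul]
  · intro i _ hib
    rw [Pi.single_eq_of_ne hib, zero_smul]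
  · simp

theorem map_piMk (f : (∀ i, R ⧸ Ideal.span {a i}) →ₗ[R] N) (c : ι → R) :
    f (piMk a c) = ∑ i, c i • f (piMk a (Pi.single i 1)) := by
  conv_lhs => rw [piMk_eq_sum, map_sum]
  exact Finset.sum_congr rfl fun i _ => map_smul f _ _

end PiQuotient

namespace ClassData

open Classical in
/-- The blocks belonging to `φ`. -/
noncomputable def blocksOf {F : Type*} [Field F] (L : ClassData F) (φ : MonicIrred F) :
    Finset L.Block := Finset.univ.filter fun b => b.1 = φ

variable {F : Type*} [Field F] {L : ClassData F}

@[simp] theorem mem_blocksOf {φ : MonicIrred F} {b : L.Block} : b ∈ L.blocksOf φ ↔ b.1 = φ := by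
  simp [blocksOf]

/-- The part of `Λ(φ)` belonging to a block. -/
def blockPart (b : L.Block) : ℕ := b.2.1

theorem blockPart_pos (b : L.Block) : 0 < blockPart b := (L.1 b.1).parts_pos Multiset.coe_mem

theorem blockPoly_eq_mul {φ : MonicIrred F} {b : L.Block} (hb : b ∈ L.blocksOf φ) :
    L.blockPoly b = φ.1 * φ.1 ^ (blockPart b - 1) := by
  rw [← pow_succ', Nat.sub_add_cancel (blockPart_pos b), ← mem_blocksOf.1 hb]
  rfl

open Classical in
theorem injective_iff_indepMod (f : L.Mod →ₗ[F[X]] L.Mod) :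
    Function.Injective f ↔ ∀ φ : MonicIrred F, IndepMod φ.1
      (fun b : L.Block => φ.1 ^ (blockPart b - 1) • f (piMk L.blockPoly (Pi.single b 1)))
      (L.blocksOf φ) := by
  constructor
  · intro hf φ c hc b hb
    let c' : L.Block → F[X] := fun b => if b ∈ L.blocksOf φ then c b * φ.1 ^ (blockPart b - 1) else 0
    have h0 : f (piMk L.blockPoly c') = 0 := by
      rw [map_piMk, ← hc]
      refine (sum_ite_mem_smul (L.blocksOf φ) _ _).trans ?_
      exact Finset.sum_congr rfl fun b _ => mul_smul _ _ _
    rw [map_eq_zero_iff f hf, piMk_eq_zero_iff] at h0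
    have h1 := h0 b
    simp only [c', if_pos hb] at h1
    rw [blockPoly_eq_mul hb] at h1
    exact (mul_dvd_mul_iff_right (pow_ne_zero _ φ.2.1.ne_zero)).1 h1
  · intro h
    have key : ∀ (φ : MonicIrred F) (m : L.Mod), φ.1 • m = 0 → f m = 0 → m = 0 := by
      intro φ m hm hfm
      obtain ⟨c, rfl⟩ := exists_piMk_eq m
      have h1 : ∀ b ∈ L.blocksOf φ, ∃ d, c b = d * φ.1 ^ (blockPart b - 1) := by
        intro b hb
        have h3 := piMk_eq_zero_iff.1 ((piMk_smul φ.1 c).trans hm) b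
        rw [blockPoly_eq_mul hb] at h3
        obtain ⟨d, hd⟩ := (mul_dvd_mul_iff_left φ.2.1.ne_zero).1 h3
        exact ⟨d, by rw [hd, mul_comm]⟩
      choose! d hd using h1
      have h2 : ∀ b, b ∉ L.blocksOf φ → piMk L.blockPoly c b = 0 := by
        intro b hb
        rw [mem_blocksOf] at hb
        refine eq_zero_of_pow_smul_eq_zero (φ := φ) (ψ := b.1) (a := blockPart b) (k := 1) (Ne.symm hb) ?_
        rw [pow_one]
        exact congrFun hm b
      let c' : L.Block → F[X] := fun b => if b ∈ L.blocksOf φ then d b * φ.1 ^ (blockPart b - 1) else 0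
      have h3 : piMk L.blockPoly c = piMk L.blockPoly c' := by
        apply _root_.funext
        intro b
        by_cases hb : b ∈ L.blocksOf φ
        · simp only [piMk_apply, c', if_pos hb, hd b hb]
        · rw [h2 b hb]
          simp only [piMk_apply, c', if_neg hb, map_zero]
      rw [h3] at hfm ⊢
      rw [map_piMk] at hfm
      have hfm := (sum_ite_mem_smul (L.blocksOf φ) _ _).symm.trans hfm
      have h4 := h φ d (by
        rw [← hfm]
        exact Finset.sum_congr rfl fun b _ => (mul_smul _ _ _).symm)
      rw [piMk_eq_zero_iff]
      intro b
      by_cases hb : b ∈ L.blocksOf φ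
      · obtain ⟨r, hr⟩ := h4 b hb
        simp only [c', if_pos hb]
        rw [blockPoly_eq_mul hb, hr]
        exact ⟨r, by ring⟩
      · simp only [c', if_neg hb]
        exact dvd_zero _
    have key2 : ∀ P : F[X], P ≠ 0 → ∀ m : L.Mod, P • m = 0 → f m = 0 → m = 0 := by
      intro P
      induction P using WfDvdMonoid.induction_on_irreducible with
      | zero => intro h; exact absurd rfl h
      | unit u hu =>
        intro _ m hm _
        obtain ⟨v, rfl⟩ := hu
        rw [← one_smul F[X] m, ← v.inv_mul, mul_smul, hm, smul_zero]
      | mul a p ha hp ih =>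
        intro _ m hm hfm
        have h1 : p • m = 0 := ih ha _ (by rw [smul_smul, mul_comm, hm]) (by
          rw [map_smul, hfm, smul_zero])
        refine key ⟨normalize p, monic_normalize hp.ne_zero,
          (normalize_associated _).irreducible_iff.2 hp⟩ m ?_ hfm
        obtain ⟨u, hu⟩ := (normalize_associated p).symm
        change normalize p • m = 0
        rw [← hu, mul_comm, mul_smul, h1, smul_zero]
    rw [injective_iff_map_eq_zero]
    intro m hm
    refine key2 (∏ b, L.blockPoly b)
      (Finset.prod_ne_zero_iff.2 fun b _ => (L.blockPoly_monic b).ne_zero) m ?_ hm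
    obtain ⟨c, rfl⟩ := exists_piMk_eq m
    rw [← piMk_smul, piMk_eq_zero_iff]
    exact fun b => (Finset.dvd_prod_of_mem _ (Finset.mem_univ b)).mul_right _

end ClassData

namespace ClassData

variable {F : Type*} [Field F] {L : ClassData F}

theorem prod_blocksOf {A : Type*} [CommMonoid A] (φ : MonicIrred F) (g : ℕ → A) :
    ∏ b ∈ L.blocksOf φ, g (blockPart b) = ((L.1 φ).parts.map g).prod := by
  classical
  rw [blocksOf, Finset.prod_filter]
  refine (L.prod_block_eq_finprod fun ψ k => if ψ = φ then g k else 1).trans ?_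
  rw [finprod_eq_single _ φ (by intro ψ h; simp [h])]
  simp

theorem card_filter_blocksOf (φ : MonicIrred F) (P : ℕ → Prop) [DecidablePred P] :
    ((L.blocksOf φ).filter fun b => P (blockPart b)).card = (L.1 φ).parts.countP P := by
  classical
  rw [Finset.card_filter, blocksOf, Finset.sum_filter]
  refine (L.sum_block_eq_finsum fun ψ k => if ψ = φ then (if P k then 1 else 0) else 0).trans ?_
  rw [finsum_eq_single _ φ (by intro ψ h; simp [h])]
  simp only [if_true]
  induction (L.1 φ).parts using Multiset.induction_on with
  | empty => simp
  | cons a s ih => rw [Multiset.map_cons, Multiset.sum_cons, Multiset.countP_cons, ih, add_comm]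

theorem blockPart_le (b : L.Block) : blockPart b ≤ (L.1 b.1).weight := by
  rw [← IntPartition.parts_sum]
  exact Multiset.le_sum_of_mem Multiset.coe_mem

theorem block_fst_mem (b : L.Block) : b.1 ∈ L.2.toFinset := by
  rw [Set.Finite.mem_toFinset]
  intro h
  have h1 := blockPart_pos b
  have h2 := blockPart_le b
  rw [h] at h2
  exact absurd h2 h1.not_ge

variable (L)

/-- The images of the standard generators under the automorphisms of the module of `L`. -/
abbrev GeneratorImages : Type _ :=
  {x : L.Block → L.Mod // (∀ b, L.blockPoly b • x b = 0) ∧ ∀ φ : MonicIrred F, IndepMod φ.1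
    (fun b : L.Block => φ.1 ^ (blockPart b - 1) • x b) (L.blocksOf φ)}

open Classical in
theorem card_aut_eq_card_generatorImages [Finite F] :
    Nat.card (L.Mod ≃ₗ[F[X]] L.Mod) = Nat.card L.GeneratorImages := by
  refine Nat.card_congr (Equiv.ofBijective (fun g =>
    ⟨fun b => g.toLinearMap (piMk L.blockPoly (Pi.single b 1)),
      smul_map_piMk_single g.toLinearMap,
      (injective_iff_indepMod g.toLinearMap).1 g.injective⟩) ⟨?_, ?_⟩)
  · intro g h hgh
    have h1 := congrFun (congrArg Subtype.val hgh)
    apply LinearEquiv.toLinearMap_injective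
    refine LinearMap.ext fun m => ?_
    obtain ⟨c, rfl⟩ := exists_piMk_eq m
    rw [map_piMk, map_piMk h.toLinearMap]
    exact Finset.sum_congr rfl fun b _ => congrArg (c b • ·) (h1 b)
  · rintro ⟨x, hx, hi⟩
    obtain ⟨f, h1⟩ := exists_linearMap_piMk_single (a := L.blockPoly) x hx
    have h2 : Function.Injective f := by
      rw [injective_iff_indepMod]
      simp_rw [h1]
      exact hi
    exact ⟨LinearEquiv.ofBijective f ⟨h2, Finite.injective_iff_surjective.1 h2⟩,
      Subtype.ext (_root_.funext h1)⟩

open Classical in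
/-- The images of the generators can be chosen independently for the different `φ`. -/
noncomputable def generatorImagesEquiv : L.GeneratorImages ≃
    ∀ φ : L.2.toFinset, SocleIndepFamily L.Mod φ.1.1 (blockPart (L := L)) (L.blocksOf φ.1) where
  toFun x φ := by
    refine ⟨fun b => if b ∈ L.blocksOf φ.1 then x.1 b else 0, fun b hb => if_neg hb,
      fun b hb => ?_, ?_⟩
    · simp only [if_pos hb]
      have := x.2.1 b
      rw [mem_blocksOf] at hb
      rw [← hb]
      exact this
    · refine (indepMod_congr fun b hb => ?_).1 (x.2.2 φ.1)
      simp only [if_pos hb]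
  invFun g := by
    refine ⟨fun b => (g ⟨b.1, block_fst_mem b⟩).1 b, fun b => ?_, fun φ => ?_⟩
    · exact (g ⟨b.1, block_fst_mem b⟩).2.2.1 b (by simp)
    · by_cases h : φ ∈ L.2.toFinset
      · refine (indepMod_congr fun b hb => ?_).1 (g ⟨φ, h⟩).2.2.2
        rw [mem_blocksOf] at hb
        subst hb
        rfl
      · intro c _ b hb
        rw [mem_blocksOf] at hb
        exact absurd (hb ▸ block_fst_mem b) h
  left_inv x := by
    apply Subtype.ext
    apply _root_.funext
    intro b
    exact if_pos (by simp)
  right_inv g := by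
    apply _root_.funext
    rintro ⟨φ, h⟩
    apply Subtype.ext
    apply _root_.funext
    intro b
    by_cases hb : b ∈ L.blocksOf φ
    · refine (if_pos hb).trans ?_
      rw [mem_blocksOf] at hb
      subst hb
      rfl
    · exact (if_neg hb).trans ((g ⟨φ, h⟩).2.1 b hb).symm

theorem card_socleIndepFamily_blocksOf [Finite F] (φ : MonicIrred F) :
    (Nat.card (SocleIndepFamily L.Mod φ.1 (blockPart (L := L)) (L.blocksOf φ)) : ℚ) =
      centralizerWeight (L.1 φ) ((Nat.card F : ℚ) ^ φ.1.natDegree) := by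
  classical
  have hQ : Nat.card (F[X] ⧸ Ideal.span {φ.1}) = Nat.card F ^ φ.1.natDegree :=
    card_cyclicModule φ.2.1
  rw [card_socleIndepFamily φ.2.2 blockPart blockPart_pos (L.1 φ).conjPart
    (fun v => by rw [hQ]; exact L.card_torsion φ v) (Finset.Icc 1 (L.1 φ).weight) (L.blocksOf φ)
    (fun b hb => by
      rw [mem_blocksOf] at hb
      rw [Finset.mem_Icc, ← hb]
      exact ⟨blockPart_pos b, blockPart_le b⟩), hQ, Nat.cast_pow]
  rw [← IntPartition.centralizerWeight_eq]
  · congr 1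
    · exact prod_blocksOf φ fun i => ((Nat.card F : ℚ) ^ φ.1.natDegree) ^
        ∑ j ∈ Finset.Icc 1 (i - 1), (L.1 φ).conjPart j
    · refine Finset.prod_congr rfl fun v _ => ?_
      rw [card_filter_blocksOf φ fun a => v < a, card_filter_blocksOf φ fun a => a = v]
      have : (L.1 φ).parts.countP (fun a => a = v) = (L.1 φ).mult v := by
        rw [IntPartition.mult, Multiset.count]
        exact Multiset.countP_congr rfl fun a _ => propext eq_comm
      rw [this]
  · exact pow_ne_zero _ (Nat.cast_ne_zero.2 Nat.card_pos.ne')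

theorem card_aut [Finite F] : (Nat.card (L.Mod ≃ₗ[F[X]] L.Mod) : ℚ) =
    ∏ φ ∈ L.2.toFinset, centralizerWeight (L.1 φ) ((Nat.card F : ℚ) ^ φ.1.natDegree) := by
  rw [L.card_aut_eq_card_generatorImages, Nat.card_congr L.generatorImagesEquiv, Nat.card_pi,
    Nat.cast_prod]
  refine Eq.trans ?_ (Finset.prod_coe_sort L.2.toFinset fun φ =>
    centralizerWeight (L.1 φ) ((Nat.card F : ℚ) ^ φ.1.natDegree))
  exact Finset.prod_congr rfl fun (φ : L.2.toFinset) _ => L.card_socleIndepFamily_blocksOf φ.1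

theorem card_specifies_mul_card_aut [Finite F] {n : ℕ} (h : L.dim = n) :
    Nat.card {A : Matrix (Fin n) (Fin n) F // L.Specifies A} * Nat.card (L.Mod ≃ₗ[F[X]] L.Mod) =
      Nat.card (Matrix.GeneralLinearGroup (Fin n) F) := by
  classical
  obtain ⟨b₀⟩ := L.exists_basis h
  have hfin := L.finite_mod
  have hfin' : Finite (Module.Basis (Fin n) F L.Mod) :=
    Finite.of_injective (fun b i => b i) fun b b' h => DFunLike.coe_injective h
  have hb : Nat.card (Module.Basis (Fin n) F L.Mod) =
      Nat.card (Matrix.GeneralLinearGroup (Fin n) F) := by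
    have e1 : Module.Basis (Fin n) F L.Mod ≃ (L.Mod ≃ₗ[F] L.Mod) :=
      { toFun := fun b => b₀.equiv b (Equiv.refl _)
        invFun := fun e => b₀.map e
        left_inv := fun b => by ext1 i; simp
        right_inv := fun e => by
          apply LinearEquiv.toLinearMap_injective
          exact b₀.ext fun i => by simp }
    have e2 : (L.Mod ≃ₗ[F] L.Mod) ≃ Matrix.GeneralLinearGroup (Fin n) F :=
      (LinearMap.GeneralLinearGroup.generalLinearEquiv F L.Mod).symm.toEquiv.trans
        (Units.mapEquiv (LinearMap.toMatrixAlgEquiv b₀).toMulEquiv).toEquiv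
    exact Nat.card_congr (e1.trans e2)
  choose mat hmat using fun b : Module.Basis (Fin n) F L.Mod => exists_isMulXMatrix b
  have e : Module.Basis (Fin n) F L.Mod ≃
      Σ A : {A : Matrix (Fin n) (Fin n) F // L.Specifies A},
        {b : Module.Basis (Fin n) F L.Mod // IsMulXMatrix b A.1} :=
    { toFun := fun b => ⟨⟨mat b, (L.specifies_iff _).2 ⟨b, hmat b⟩⟩, b, hmat b⟩
      invFun := fun x => x.2.1
      left_inv := fun b => rfl
      right_inv := by
        rintro ⟨⟨A, hA⟩, b, hb⟩
        obtain rfl : mat b = A := (hmat b).unique hb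
        rfl }
  have e3 : ∀ A : {A : Matrix (Fin n) (Fin n) F // L.Specifies A},
      Nat.card {b : Module.Basis (Fin n) F L.Mod // IsMulXMatrix b A.1} =
        Nat.card (L.Mod ≃ₗ[F[X]] L.Mod) := by
    rintro ⟨A, hA⟩
    obtain ⟨b, hb⟩ := (L.specifies_iff A).1 hA
    refine (Nat.card_congr (Equiv.ofBijective (fun g => ⟨_, hb.map g⟩) ⟨?_, ?_⟩)).symm
    · intro g h hgh
      have h1 := congrArg Subtype.val hgh
      have h2 : (g.restrictScalars F).toLinearMap = (h.restrictScalars F).toLinearMap :=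
        b.ext fun i => by
          have := DFunLike.congr_fun h1 i
          simpa using this
      exact LinearEquiv.ext fun m => DFunLike.congr_fun h2 m
    · rintro ⟨b', hb'⟩
      refine ⟨hb.linearEquiv hb', Subtype.ext ?_⟩
      ext1 i
      exact hb.linearEquiv_apply hb' i
  have := Fintype.ofFinite {A : Matrix (Fin n) (Fin n) F // L.Specifies A}
  rw [← hb, Nat.card_congr e, Nat.card_sigma, Finset.sum_congr rfl fun A _ => e3 A, Finset.sum_const,
    Finset.card_univ, ← Nat.card_eq_fintype_card, smul_eq_mul]

theorem card_specifies_div [Finite F] {n : ℕ} (h : L.dim = n) :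
    (Nat.card {A : Matrix (Fin n) (Fin n) F // L.Specifies A} : ℚ) /
      Nat.card (Matrix.GeneralLinearGroup (Fin n) F) =
    ∏ φ ∈ L.2.toFinset, 1 / centralizerWeight (L.1 φ) ((Nat.card F : ℚ) ^ φ.1.natDegree) := by
  have h1 := L.card_specifies_mul_card_aut h
  have h2 : (Nat.card (Matrix.GeneralLinearGroup (Fin n) F) : ℚ) ≠ 0 :=
    Nat.cast_ne_zero.2 Nat.card_pos.ne'
  rw [← h1] at h2 ⊢
  push_cast at h2 ⊢
  rw [Finset.prod_div_distrib, Finset.prod_const_one, ← L.card_aut]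
  have h3 := left_ne_zero_of_mul h2
  field_simp

end ClassData

section FormalSeries

open scoped PowerSeries.WithPiTopology

theorem hasFormalProd_of_eventually_coeff {ι : Type*} {f : ι → PowerSeries ℚ} {g : PowerSeries ℚ}
    (h : ∀ n, ∃ s₀ : Finset ι, ∀ s, s₀ ⊆ s →
      PowerSeries.coeff n (∏ i ∈ s, f i) = PowerSeries.coeff n g) : HasFormalProd f g := by
  let _ : TopologicalSpace ℚ := ⊥
  have : DiscreteTopology ℚ := ⟨rfl⟩
  unfold HasFormalProd
  rw [HasProd, SummationFilter.unconditional_filter]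
  refine (PowerSeries.WithPiTopology.tendsto_iff_coeff_tendsto ℚ _ _ _).2 fun n => ?_
  rw [nhds_discrete, Filter.tendsto_pure, Filter.eventually_atTop]
  exact h n

theorem IntPartition.finite_weight_le (n : ℕ) : {l : IntPartition | l.weight ≤ n}.Finite := by
  refine ((Set.finite_Iic n).biUnion fun k _ =>
    Set.finite_range fun p : Nat.Partition k => (⟨k, p⟩ : IntPartition)).subset ?_
  rintro ⟨k, p⟩ hk
  exact Set.mem_biUnion (show k ∈ Set.Iic n from hk) ⟨p, rfl⟩

/-- The elements of `S` of weight at most `n`. -/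
noncomputable def truncatedSet (S : Set IntPartition) (n : ℕ) : Finset IntPartition :=
  ((IntPartition.finite_weight_le n).inter_of_left S).toFinset

theorem mem_truncatedSet {S : Set IntPartition} {n : ℕ} {l : IntPartition} :
    l ∈ truncatedSet S n ↔ l.weight ≤ n ∧ l ∈ S := by
  simp [truncatedSet]

theorem coeff_partitionSeries (S : Set IntPartition) (w : IntPartition → ℚ) {d k n : ℕ}
    (hd : 1 ≤ d) (hk : k ≤ n) : PowerSeries.coeff k (partitionSeries S w d) =
      PowerSeries.coeff k (∑ l ∈ truncatedSet S n, PowerSeries.monomial (l.weight * d) (w l)) := by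
  classical
  let _ : TopologicalSpace ℚ := ⊥
  have : DiscreteTopology ℚ := ⟨rfl⟩
  have h1 : HasSum _ _ := hasFormalSum_partitionSeries S w d hd
  have h2 := (PowerSeries.WithPiTopology.hasSum_iff_hasSum_coeff ℚ).1 h1 k
  have h3 := hasSum_sum_of_ne_finset_zero (L := SummationFilter.unconditional S)
    (f := fun l : S => PowerSeries.coeff k (PowerSeries.monomial (l.1.weight * d) (w l.1)))
    (s := (truncatedSet S n).subtype (· ∈ S)) (by
      intro l hl
      rw [PowerSeries.coeff_monomial, if_neg]
      intro hkl
      apply hl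
      rw [Finset.mem_subtype, mem_truncatedSet]
      exact ⟨(Nat.le_mul_of_pos_right _ hd).trans (hkl ▸ hk), l.2⟩)
  rw [h2.unique h3, map_sum]
  exact Finset.sum_subtype_of_mem (p := (· ∈ S))
    (fun l => PowerSeries.coeff k (PowerSeries.monomial (l.weight * d) (w l)))
    fun l hl => (mem_truncatedSet.1 hl).2

theorem PowerSeries.coeff_prod_congr {ι R : Type*} [CommSemiring R] (s : Finset ι)
    {f g : ι → PowerSeries R} {n : ℕ}
    (h : ∀ i ∈ s, ∀ k ≤ n, PowerSeries.coeff k (f i) = PowerSeries.coeff k (g i)) :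
    PowerSeries.coeff n (∏ i ∈ s, f i) = PowerSeries.coeff n (∏ i ∈ s, g i) := by
  classical
  rw [PowerSeries.coeff_prod, PowerSeries.coeff_prod]
  refine Finset.sum_congr rfl fun l hl => Finset.prod_congr rfl fun i hi => h i hi _ ?_
  rw [Finset.mem_finsuppAntidiag] at hl
  rw [← hl.1]
  exact Finset.single_le_sum (f := fun j => l j) (fun _ _ => Nat.zero_le _) hi

end FormalSeries

section FiniteField

variable {F : Type*} [Field F]

theorem MonicIrred.natDegree_pos (φ : MonicIrred F) : 1 ≤ φ.1.natDegree := φ.2.2.natDegree_pos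

theorem MonicIrred.finite_natDegree_le [Finite F] (n : ℕ) :
    {φ : MonicIrred F | φ.1.natDegree ≤ n}.Finite := by
  refine Set.Finite.of_injOn (f := fun φ : MonicIrred F => fun i : Fin (n + 1) => φ.1.coeff i)
    (t := Set.univ) (fun _ _ => Set.mem_univ _) ?_ Set.finite_univ
  intro φ hφ ψ hψ h
  apply Subtype.ext
  ext k
  by_cases hk : k ≤ n
  · exact congrFun h ⟨k, by omega⟩
  · have h1 : φ.1.natDegree ≤ n := hφ
    have h2 : ψ.1.natDegree ≤ n := hψ
    rw [coeff_eq_zero_of_natDegree_lt (by omega), coeff_eq_zero_of_natDegree_lt (by omega)]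

namespace ClassData

theorem dim_eq_sum (L : ClassData F) {s : Finset (MonicIrred F)} (hs : L.2.toFinset ⊆ s) :
    L.dim = ∑ φ ∈ s, (L.1 φ).weight * φ.1.natDegree := by
  refine finsum_eq_sum_of_support_subset _ fun φ hφ => hs ?_
  rw [Set.Finite.mem_toFinset]
  intro h
  apply hφ
  change (L.1 φ).weight * _ = 0
  rw [(IntPartition.eq_empty_iff _).1 h, zero_mul]

theorem weight_mul_natDegree_le (L : ClassData F) (φ : MonicIrred F) :
    (L.1 φ).weight * φ.1.natDegree ≤ L.dim := by
  classical
  rw [L.dim_eq_sum (Finset.subset_insert φ _)]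
  exact Finset.single_le_sum (f := fun φ : MonicIrred F => (L.1 φ).weight * φ.1.natDegree)
    (fun _ _ => Nat.zero_le _) (Finset.mem_insert_self φ _)

theorem weight_le_dim (L : ClassData F) (φ : MonicIrred F) : (L.1 φ).weight ≤ L.dim :=
  (Nat.le_mul_of_pos_right _ φ.natDegree_pos).trans (L.weight_mul_natDegree_le φ)

theorem natDegree_le_dim (L : ClassData F) {φ : MonicIrred F} (h : φ ∈ L.2.toFinset) :
    φ.1.natDegree ≤ L.dim := by
  rw [Set.Finite.mem_toFinset] at h
  have h1 : (L.1 φ).weight ≠ 0 := fun h0 => h ((IntPartition.eq_empty_iff _).2 h0)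
  exact (Nat.le_mul_of_pos_left _ (Nat.pos_of_ne_zero h1)).trans (L.weight_mul_natDegree_le φ)

theorem finite_dim_eq [Finite F] (n : ℕ) : {L : ClassData F | L.dim = n}.Finite := by
  choose A hA using fun L : {L : ClassData F // L.dim = n} => L.1.exists_specifies L.2
  refine Set.finite_coe_iff.1 <| Finite.of_injective A fun L L' h => Subtype.ext ?_
  have := hA L
  rw [h] at this
  exact this.unique (hA L')

/-- The class data of dimension `n` with values in the given sets of partitions. -/
noncomputable def restricted [Finite F] (S : MonicIrred F → Set IntPartition) (n : ℕ) :
    Finset (ClassData F) :=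
  (Set.Finite.subset (finite_dim_eq n)
    (fun _ h => h.1 : {L : ClassData F | L.dim = n ∧ ∀ φ, L.1 φ ∈ S φ} ⊆ {L | L.dim = n})).toFinset

theorem mem_restricted [Finite F] {S : MonicIrred F → Set IntPartition} {n : ℕ} {L : ClassData F} :
    L ∈ restricted S n ↔ L.dim = n ∧ ∀ φ, L.1 φ ∈ S φ := by
  simp [restricted]

open Classical in
theorem coeff_prod_partitionSeries [Finite F] {S : MonicIrred F → Set IntPartition}
    (hS : ∀ φ, IntPartition.empty ∈ S φ) (w : MonicIrred F → IntPartition → ℚ)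
    (hw : ∀ φ, w φ IntPartition.empty = 1) {n : ℕ} {s : Finset (MonicIrred F)}
    (hs : ∀ φ : MonicIrred F, φ.1.natDegree ≤ n → φ ∈ s) :
    PowerSeries.coeff n (∏ φ ∈ s, partitionSeries (S φ) (w φ) φ.1.natDegree) =
      ∑ L ∈ restricted S n, ∏ φ ∈ L.2.toFinset, w φ (L.1 φ) := by
  rw [PowerSeries.coeff_prod_congr s fun φ _ k hk =>
    coeff_partitionSeries (S φ) (w φ) φ.natDegree_pos hk, Finset.prod_sum, map_sum]
  have h1 : ∀ p : ∀ φ ∈ s, IntPartition,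
      PowerSeries.coeff n (∏ φ ∈ s.attach, PowerSeries.monomial
        ((p φ.1 φ.2).weight * φ.1.1.natDegree) (w φ.1 (p φ.1 φ.2))) =
      if n = ∑ φ ∈ s.attach, (p φ.1 φ.2).weight * φ.1.1.natDegree then
        ∏ φ ∈ s.attach, w φ.1 (p φ.1 φ.2) else 0 := by
    intro p
    rw [PowerSeries.prod_monomial, PowerSeries.coeff_monomial]
  rw [Finset.sum_congr rfl fun p _ => h1 p, ← Finset.sum_filter]
  have hsub : ∀ L ∈ restricted S n, L.2.toFinset ⊆ s := fun L hL φ hφ =>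
    hs φ ((L.natDegree_le_dim hφ).trans (mem_restricted.1 hL).1.le)
  let toData : (∀ φ ∈ s, IntPartition) → ClassData F := fun p =>
    ⟨fun φ => if h : φ ∈ s then p φ h else IntPartition.empty,
      s.finite_toSet.subset fun φ hφ => by
        by_contra h
        exact hφ (dif_neg h)⟩
  have htoData : ∀ p φ (h : φ ∈ s), (toData p).1 φ = p φ h := fun p φ h => dif_pos h
  have hsub' : ∀ p, (toData p).2.toFinset ⊆ s := by
    intro p φ hφ
    rw [Set.Finite.mem_toFinset] at hφ
    by_contra h
    exact hφ (dif_neg h)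
  have hdim : ∀ p, (toData p).dim = ∑ φ ∈ s.attach, (p φ.1 φ.2).weight * φ.1.1.natDegree := by
    intro p
    rw [(toData p).dim_eq_sum (hsub' p), ← Finset.sum_attach]
    exact Finset.sum_congr rfl fun φ _ => by rw [htoData p φ.1 φ.2]
  symm
  refine Finset.sum_bij' (fun L _ φ _ => L.1 φ) (fun p _ => toData p) ?_ ?_ ?_ ?_ ?_
  · intro L hL
    have hL' := mem_restricted.1 hL
    rw [Finset.mem_filter, Finset.mem_pi]
    refine ⟨fun φ _ => mem_truncatedSet.2 ⟨(L.weight_le_dim φ).trans hL'.1.le, hL'.2 φ⟩, ?_⟩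
    rw [← hL'.1, L.dim_eq_sum (hsub L hL), ← Finset.sum_attach]
  · intro p hp
    rw [Finset.mem_filter, Finset.mem_pi] at hp
    refine mem_restricted.2 ⟨(hdim p).trans hp.2.symm, fun φ => ?_⟩
    by_cases h : φ ∈ s
    · rw [htoData p φ h]
      exact (mem_truncatedSet.1 (hp.1 φ h)).2
    · have : (toData p).1 φ = IntPartition.empty := dif_neg h
      rw [this]
      exact hS φ
  · intro L hL
    apply Subtype.ext
    apply _root_.funext
    intro φ
    by_cases h : φ ∈ s
    · exact dif_pos h
    · refine (dif_neg h).trans ?_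
      by_contra h'
      exact h (hsub L hL (L.2.mem_toFinset.2 (Ne.symm h')))
  · intro p _
    funext φ h
    exact htoData p φ h
  · intro L hL
    rw [Finset.prod_attach s fun φ => w φ (L.1 φ)]
    refine Finset.prod_subset (hsub L hL) fun φ _ hφ => ?_
    rw [Set.Finite.mem_toFinset] at hφ
    have : L.1 φ = IntPartition.empty := not_not.1 hφ
    rw [this, hw]

end ClassData

theorem hasFormalProd_partitionSeries [Finite F] {S : MonicIrred F → Set IntPartition}
    (hS : ∀ φ, IntPartition.empty ∈ S φ) (w : MonicIrred F → IntPartition → ℚ)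
    (hw : ∀ φ, w φ IntPartition.empty = 1) {g : PowerSeries ℚ}
    (hg : ∀ n, PowerSeries.coeff n g =
      ∑ L ∈ ClassData.restricted S n, ∏ φ ∈ L.2.toFinset, w φ (L.1 φ)) :
    HasFormalProd (fun φ : MonicIrred F => partitionSeries (S φ) (w φ) φ.1.natDegree) g := by
  refine hasFormalProd_of_eventually_coeff fun n =>
    ⟨(MonicIrred.finite_natDegree_le n).toFinset, fun s hs => ?_⟩
  rw [hg, ClassData.coeff_prod_partitionSeries hS w hw fun φ hφ => hs (by simpa using hφ)]

theorem hasFormalProd_partitionSeries_degree [Finite F] {S : Set IntPartition}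
    (hS : IntPartition.empty ∈ S) (w : ℕ → IntPartition → ℚ)
    (hw : ∀ d, w d IntPartition.empty = 1) {g : PowerSeries ℚ}
    (hg : ∀ n, PowerSeries.coeff n g = ∑ L ∈ ClassData.restricted (fun _ : MonicIrred F => S) n,
      ∏ φ ∈ L.2.toFinset, w φ.1.natDegree (L.1 φ)) :
    HasFormalProd (fun d : ℕ+ => partitionSeries S (w d) d ^ numIrred F d) g := by
  classical
  refine hasFormalProd_of_eventually_coeff fun n =>
    ⟨Finset.Iic (n.succPNat), fun t ht => ?_⟩
  let D : MonicIrred F → ℕ+ := fun φ => ⟨φ.1.natDegree, φ.natDegree_pos⟩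
  have hfin : {φ : MonicIrred F | D φ ∈ t}.Finite := by
    refine (MonicIrred.finite_natDegree_le (∑ d ∈ t, (d : ℕ))).subset fun φ hφ => ?_
    exact Finset.single_le_sum (f := fun d : ℕ+ => (d : ℕ)) (fun _ _ => Nat.zero_le _) hφ
  have hmem : ∀ φ, φ ∈ hfin.toFinset ↔ D φ ∈ t := fun φ => by simp
  have hprod : ∏ d ∈ t, partitionSeries S (w d) d ^ numIrred F d =
      ∏ φ ∈ hfin.toFinset, partitionSeries S (w φ.1.natDegree) φ.1.natDegree := by
    rw [← Finset.prod_fiberwise_of_maps_to (g := D) fun φ hφ => (hmem φ).1 hφ]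
    refine Finset.prod_congr rfl fun d hd => ?_
    rw [Finset.prod_congr rfl (g := fun _ => partitionSeries S (w d) d), Finset.prod_const]
    · congr 1
      refine Nat.subtype_card _ fun φ => ?_
      rw [Finset.mem_filter, hmem]
      refine ⟨fun h => congrArg PNat.val h.2, fun h => ?_⟩
      have h' : D φ = d := PNat.eq h
      exact ⟨h' ▸ hd, h'⟩
    · intro φ hφ
      rw [← (Finset.mem_filter.1 hφ).2]
      rfl
  rw [hprod, hg]
  refine ClassData.coeff_prod_partitionSeries (fun _ => hS) (fun φ => w φ.1.natDegree)
    (fun _ => hw _) fun φ hφ => ?_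
  rw [hmem]
  refine ht ?_
  rw [Finset.mem_Iic, ← PNat.coe_le_coe]
  exact hφ.trans n.le_succ

end FiniteField

theorem IntPartition.centralizerWeight_empty (Q : ℚ) : centralizerWeight empty Q = 1 := by
  have : empty.weight = 0 := rfl
  simp [centralizerWeight, this]

section Restricted

variable {F : Type*} [Field F] [Finite F]

theorem ClassData.restricted_zero {S : MonicIrred F → Set IntPartition}
    (hS : ∀ φ, IntPartition.empty ∈ S φ) (f : ClassData F → ℚ)
    (hf : ∀ L : ClassData F, (∀ φ, L.1 φ = IntPartition.empty) → f L = 1) :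
    ∑ L ∈ restricted S 0, f L = 1 := by
  let L₀ : ClassData F := ⟨fun _ => IntPartition.empty, by simp⟩
  have : restricted S 0 = {L₀} := by
    ext L
    rw [mem_restricted, Finset.mem_singleton]
    constructor
    · rintro ⟨h, -⟩
      apply Subtype.ext
      apply _root_.funext
      intro φ
      have := L.weight_le_dim φ
      rw [h, Nat.le_zero] at this
      exact (IntPartition.eq_empty_iff _).2 this
    · rintro rfl
      refine ⟨?_, hS⟩
      have h0 : L₀.2.toFinset ⊆ ∅ := fun φ hφ => absurd rfl (L₀.2.mem_toFinset.1 hφ)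
      rw [L₀.dim_eq_sum h0, Finset.sum_empty]
  rw [this, Finset.sum_singleton, hf]
  exact fun _ => rfl

variable {C : ∀ n : ℕ, Set (Matrix (Fin n) (Fin n) F)} {S : MonicIrred F → Set IntPartition}

theorem IsPartitionRestricted.mem_restricted (h : IsPartitionRestricted C S) {n : ℕ} (hn : 1 ≤ n)
    {A : Matrix (Fin n) (Fin n) F} (hA : A ∈ C n) {L : ClassData F} (hL : L.Specifies A) :
    L ∈ ClassData.restricted S n := by
  have h1 : L ∈ {L : ClassData F | ∃ A ∈ C n, L.Specifies A} := ⟨A, hA, hL⟩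
  rw [h.2 n hn] at h1
  exact ClassData.mem_restricted.2 h1

theorem IsPartitionRestricted.mem (h : IsPartitionRestricted C S) (hC : IsUnionOfClasses C) {n : ℕ}
    (hn : 1 ≤ n) {A : Matrix (Fin n) (Fin n) F} {L : ClassData F}
    (hL : L ∈ ClassData.restricted S n) (hA : L.Specifies A) : A ∈ C n := by
  have h1 : L ∈ {L : ClassData F | L.dim = n ∧ ∀ φ, L.1 φ ∈ S φ} := ClassData.mem_restricted.1 hL
  rw [← h.2 n hn] at h1
  obtain ⟨B, hB, hLB⟩ := h1
  exact hC n hn B hB A (hLB.isConj hA)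

theorem IsPartitionRestricted.ncard_eq_sum (h : IsPartitionRestricted C S) (hC : IsUnionOfClasses C)
    {n : ℕ} (hn : 1 ≤ n) : (C n).ncard = ∑ L ∈ ClassData.restricted S n,
      Nat.card {A : Matrix (Fin n) (Fin n) F // L.Specifies A} := by
  choose L hL using fun A : Matrix (Fin n) (Fin n) F => ClassData.exists_specifies_matrix A
  have e : C n ≃ Σ L : ClassData.restricted S n,
      {A : Matrix (Fin n) (Fin n) F // L.1.Specifies A} :=
    { toFun := fun A => ⟨⟨L A.1, h.mem_restricted hn A.2 (hL A.1)⟩, A.1, hL A.1⟩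
      invFun := fun x => ⟨x.2.1, h.mem hC hn x.1.2 x.2.2⟩
      left_inv := fun A => rfl
      right_inv := by
        rintro ⟨⟨L', hL'⟩, A, hA⟩
        obtain rfl : L A = L' := (hL A).unique hA
        rfl }
  rw [← Nat.card_coe_set_eq, Nat.card_congr e, Nat.card_sigma]
  exact Finset.sum_coe_sort (ClassData.restricted S n) fun L =>
    Nat.card {A : Matrix (Fin n) (Fin n) F // L.Specifies A}

theorem IsPartitionRestricted.ncard_conjClasses (h : IsPartitionRestricted C S)
    (hC : IsUnionOfClasses C) {n : ℕ} (hn : 1 ≤ n) :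
    (ConjClasses.mk '' C n).ncard = (ClassData.restricted S n).card := by
  rw [← Set.ncard_coe_finset]
  symm
  choose A hA using fun L : ClassData.restricted S n =>
    L.1.exists_specifies (ClassData.mem_restricted.1 L.2).1
  refine Set.ncard_congr (fun L hL => ConjClasses.mk (A ⟨L, hL⟩)) ?_ ?_ ?_
  · exact fun L hL => ⟨_, h.mem hC hn hL (hA ⟨L, hL⟩), rfl⟩
  · intro L L' hL hL' hLL
    exact ((hA ⟨L, hL⟩).of_isConj (ConjClasses.mk_eq_mk_iff_isConj.1 hLL)).unique (hA ⟨L', hL'⟩)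
  · rintro _ ⟨B, hB, rfl⟩
    obtain ⟨L, hL⟩ := ClassData.exists_specifies_matrix B
    have hm := h.mem_restricted hn hB hL
    exact ⟨L, hm, ConjClasses.mk_eq_mk_iff_isConj.2 ((hA ⟨L, hm⟩).isConj hL)⟩

theorem IsPartitionRestricted.coeff_elementSeries (h : IsPartitionRestricted C S)
    (hC : IsUnionOfClasses C) (n : ℕ) : PowerSeries.coeff n (elementSeries C) =
      ∑ L ∈ ClassData.restricted S n, ∏ φ ∈ L.2.toFinset,
        1 / centralizerWeight (L.1 φ) ((Nat.card F : ℚ) ^ φ.1.natDegree) := by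
  rw [elementSeries, PowerSeries.coeff_mk]
  split_ifs with hn
  · subst hn
    refine (ClassData.restricted_zero h.1 _ fun L hL => Finset.prod_eq_one fun φ _ => ?_).symm
    rw [hL, IntPartition.centralizerWeight_empty, div_one]
  · rw [h.ncard_eq_sum hC (Nat.pos_of_ne_zero hn), Nat.cast_sum, Finset.sum_div]
    exact Finset.sum_congr rfl fun L hL => L.card_specifies_div (ClassData.mem_restricted.1 hL).1

theorem IsPartitionRestricted.coeff_classSeries (h : IsPartitionRestricted C S)
    (hC : IsUnionOfClasses C) (n : ℕ) : PowerSeries.coeff n (classSeries C) =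
      ∑ L ∈ ClassData.restricted S n, ∏ _φ ∈ L.2.toFinset, (1 : ℚ) := by
  rw [classSeries, PowerSeries.coeff_mk]
  split_ifs with hn
  · subst hn
    exact (ClassData.restricted_zero h.1 _ fun L hL => Finset.prod_const_one).symm
  · rw [h.ncard_conjClasses hC (Nat.pos_of_ne_zero hn)]
    simp

end Restricted

theorem mainTheorem5 {F : Type*} [Field F] [Finite F]
    (C : ∀ n : ℕ, Set (Matrix (Fin n) (Fin n) F)) (hC : IsUnionOfClasses C) :
    (∀ S : MonicIrred F → Set IntPartition, IsPartitionRestricted C S →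
      HasFormalProd
        (fun φ : MonicIrred F => partitionSeries (S φ)
          (fun l => 1 / centralizerWeight l ((Nat.card F : ℚ) ^ φ.1.natDegree)) φ.1.natDegree)
        (elementSeries C) ∧
      HasFormalProd
        (fun φ : MonicIrred F => partitionSeries (S φ) (fun _ => 1) φ.1.natDegree)
        (classSeries C)) ∧
    (∀ S : Set IntPartition, IsPartitionUniform C S →
      HasFormalProd
        (fun d : ℕ+ => partitionSeries S
          (fun l => 1 / centralizerWeight l ((Nat.card F : ℚ) ^ (d : ℕ))) d ^ numIrred F d)
        (elementSeries C) ∧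
      HasFormalProd
        (fun d : ℕ+ => partitionSeries S (fun _ => 1) d ^ numIrred F d)
        (classSeries C)) := by
  have hw : ∀ d : ℕ, 1 / centralizerWeight IntPartition.empty ((Nat.card F : ℚ) ^ d) = 1 :=
    fun d => by rw [IntPartition.centralizerWeight_empty, div_one]
  refine ⟨fun S h => ⟨?_, ?_⟩, fun S h => ⟨?_, ?_⟩⟩
  · exact hasFormalProd_partitionSeries h.1
      (fun φ l => 1 / centralizerWeight l ((Nat.card F : ℚ) ^ φ.1.natDegree))
      (fun φ => hw _) (h.coeff_elementSeries hC)
  · exact hasFormalProd_partitionSeries h.1 (fun _ _ => 1) (fun _ => rfl) (h.coeff_classSeries hC)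
  · have hr : IsPartitionRestricted C fun _ => S := h
    exact hasFormalProd_partitionSeries_degree (hr.1 ⟨X, monic_X, irreducible_X⟩)
      (fun d l => 1 / centralizerWeight l ((Nat.card F : ℚ) ^ d)) hw (hr.coeff_elementSeries hC)
  · have hr : IsPartitionRestricted C fun _ => S := h
    exact hasFormalProd_partitionSeries_degree (hr.1 ⟨X, monic_X, irreducible_X⟩)
      (fun _ _ => 1) (fun _ => rfl) (hr.coeff_classSeries hC)
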